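/- **Theorem 7.2 (Posterior mean).** Let $\mathfrak X$ be a Polish space with its Borel $\sigma$-field $\mathcal X$, let $a$ be a finite atomless Borel measure on $\mathfrak X$, and let $b:\mathfrak X\to(0,\infty)$ be measurable. Let $U$ be the completely random measure without fixed atoms and with intensity measure $s^{-1}e^{-sb(x)}\,ds\,a(dx)$ on $\mathfrak X\times(0,\infty)$, that is, $U(A)=\int_A\int_0^\infty s\,N(dx,ds)$ for a Poisson process $N$ with this intensity. Assume that $0<U(\mathfrak X)<\infty$ almost surely (as is the case if $a\neq0$ and $b$ is bounded away from $0$), and let the prior be the law of the random probability measure $P=U/U(\mathfrak X)$. For $n\ge1$ and $x_1,\dots,x_n\in\mathfrak X$, let $\Pi_n(\cdot\mid x_1,\dots,x_n)$ be the law of the random probability measure $$P_n=\frac{\Psi+\sum_{i=1}^nW_i\delta_{x_i}}{\Psi(\mathfrak X)+\sum_{i=1}^nW_i},$$ where $\Lambda$ has Lebesgue density on $(0,\infty)$ proportional to $\lambda^{n-1}e^{-\psi(\lambda)}\prod_{i=1}^n(\lambda+b(x_i))^{-1}$ with $\psi(\lambda)=\int\!\int_0^\infty(1-e^{-\lambda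 s})s^{-1}e^{-sb(x)}\,ds\,a(dx)$, and where, given $\Lambda=\lambda$, the completely random measure $\Psi$ has no fixed atoms and intensity measure $s^{-1}e^{-s(\lambda+b(x))}\,ds\,a(dx)$, the $W_i$ are exponential with rates $\lambda+b(x_i)$, and $\Psi,W_1,\dots,W_n$ are independent. Then $\Pi_n$ is, for every $n\ge1$, a version of the posterior distribution of $P$ given $X_1,\dots,X_n$ in the model in which $P$ has the above prior and $X_1,\dots,X_n\mid P$ are i.i.d. with law $P$. Moreover, for every Borel probability measure $P_0$ on $\mathfrak X$ and $P_0^\infty$-almost every sequence $X_1,X_2,\dots$, with this version of the posterior and with $\mathbb P_n=n^{-1}\sum_{i=1}^n\delta_{X_i}$, $$\sup_{A\in\mathcal X}\bigl|\mathbb E\bigl(P_n(A)\mid X_1,\dots,X_n\bigr)-\mathbb P_n(A)\bigr|=O(1/n),\qquad n\to\infty .$$ -/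

import Mathlib

open MeasureTheory ProbabilityTheory Filter Asymptotics
open scoped ENNReal NNReal Nat

noncomputable section

namespace ExtGamma

/-! ### Poisson processes and their laws on the space of measures -/

/-- Law of the Poisson process with finite intensity measure `m`:
the number of points is Poisson with mean `m(E)`, and given their number the points are i.i.d.
with law `m / m(E)`. Equivalently the law is the sum over `k` of `e^{-m(E)} / k!` times the image of
the `k`-fold product of `m` under the map sending `(y₁, …, y_k)` to `δ_{y₁} + … + δ_{y_k}`. -/
def finitePoissonLaw {E : Type*} [MeasurableSpace E] (m : Measure E) : Measure (Measure E) :=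
  ENNReal.ofReal (Real.exp (-(m Set.univ).toReal)) •
    Measure.sum fun k : ℕ =>
      ((k ! : ℕ) : ℝ≥0∞)⁻¹ •
        (Measure.pi fun _ : Fin k => m).map fun y => ∑ i, Measure.dirac (y i)

theorem measurable_sum_dirac {E : Type*} [MeasurableSpace E] (k : ℕ) :
    Measurable fun y : Fin k → E => ∑ i, Measure.dirac (y i) := by
  refine Measure.measurable_of_measurable_coe _ fun s hs => ?_
  simp only [Measure.coe_finsetSum, Finset.sum_apply]
  exact Finset.measurable_sum _ fun i _ =>
    (Measure.measurable_coe hs).comp (Measure.measurable_dirac.comp (measurable_pi_apply i))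

instance finitePoissonLaw.isProbabilityMeasure {E : Type*} [MeasurableSpace E] (m : Measure E)
    [IsFiniteMeasure m] : IsProbabilityMeasure (finitePoissonLaw m) := by
  constructor
  set r : ℝ := (m Set.univ).toReal with hr
  have hr0 : 0 ≤ r := ENNReal.toReal_nonneg
  have hm : m Set.univ = ENNReal.ofReal r := (ENNReal.ofReal_toReal (measure_ne_top m _)).symm
  have hterm : ∀ k : ℕ, (((k ! : ℕ) : ℝ≥0∞)⁻¹ •
      (Measure.pi fun _ : Fin k => m).map fun y => ∑ i, Measure.dirac (y i)) Set.univ =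
      ENNReal.ofReal (r ^ k / (k ! : ℝ)) := by
    intro k
    rw [Measure.smul_apply, Measure.map_apply (measurable_sum_dirac k) MeasurableSet.univ,
      Set.preimage_univ, Measure.pi_univ, hm]
    have hk : (0 : ℝ) < (k ! : ℝ) := by exact_mod_cast Nat.factorial_pos k
    rw [ENNReal.ofReal_div_of_pos hk, ENNReal.ofReal_pow hr0, ENNReal.ofReal_natCast,
      ENNReal.div_eq_inv_mul]
    simp
  rw [finitePoissonLaw, Measure.smul_apply, Measure.sum_apply _ MeasurableSet.univ]
  simp_rw [hterm]
  have hs : HasSum (fun k : ℕ => r ^ k / (k ! : ℝ)) (Real.exp r) := by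
    rw [Real.exp_eq_exp_ℝ]
    exact NormedSpace.expSeries_div_hasSum_exp r
  rw [← ENNReal.ofReal_tsum_of_nonneg (fun k => by positivity) hs.summable, hs.tsum_eq,
    smul_eq_mul, ← ENNReal.ofReal_mul (Real.exp_pos _).le, ← Real.exp_add]
  simp [hr]

/-- Law of the Poisson process with intensity measure `ν`, where the sets `S k` are disjoint and
measurable, carry `ν`, and have finite `ν`-measure: the superposition of independent
Poisson processes with the finite intensities `ν` restricted to `S k`. -/
def poissonLaw {E : Type*} [MeasurableSpace E] (ν : Measure E) (S : ℤ → Set E)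
    [∀ k, IsFiniteMeasure (ν.restrict (S k))] : Measure (Measure E) :=
  (Measure.infinitePi fun k => finitePoissonLaw (ν.restrict (S k))).map Measure.sum

/-! ### The extended gamma completely random measure -/

/-- The intensity measure `s⁻¹ e^{-s c(x)} ds a(dx)` on `𝔛 × (0,∞)`. -/
def intensity {X : Type*} [MeasurableSpace X] (a : Measure X) (c : X → ℝ≥0) : Measure (X × ℝ) :=
  (a.prod (volume.restrict (Set.Ioi (0 : ℝ)))).withDensity fun p =>
    ENNReal.ofReal (p.2⁻¹ * Real.exp (-(p.2 * (c p.1 : ℝ))))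

/-- The dyadic layers `𝔛 × (2^k, 2^{k+1}]`, `k ∈ ℤ`, which partition `𝔛 × (0,∞)`. -/
def layer (X : Type*) (k : ℤ) : Set (X × ℝ) :=
  Set.univ ×ˢ Set.Ioc ((2 : ℝ) ^ k) ((2 : ℝ) ^ (k + 1))

instance intensity.isFiniteMeasure_restrict_layer {X : Type*} [MeasurableSpace X] (a : Measure X)
    [IsFiniteMeasure a] (c : X → ℝ≥0) (k : ℤ) :
    IsFiniteMeasure ((intensity a c).restrict (layer X k)) := by
  have hl : MeasurableSet (layer X k) := MeasurableSet.univ.prod measurableSet_Ioc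
  have h2 : (0 : ℝ) < (2 : ℝ) ^ k := by positivity
  refine isFiniteMeasure_restrict.2 (ne_of_lt ?_)
  rw [intensity, withDensity_apply _ hl]
  calc ∫⁻ p in layer X k, ENNReal.ofReal (p.2⁻¹ * Real.exp (-(p.2 * (c p.1 : ℝ))))
        ∂(a.prod (volume.restrict (Set.Ioi (0 : ℝ))))
      ≤ ∫⁻ _ in layer X k, ENNReal.ofReal ((2 : ℝ) ^ k)⁻¹
        ∂(a.prod (volume.restrict (Set.Ioi (0 : ℝ)))) := by
        refine setLIntegral_mono' hl fun p hp => ENNReal.ofReal_le_ofReal ?_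
        have hp2 : (2 : ℝ) ^ k < p.2 := hp.2.1
        have hp0 : 0 < p.2 := h2.trans hp2
        calc p.2⁻¹ * Real.exp (-(p.2 * (c p.1 : ℝ))) ≤ p.2⁻¹ * 1 := by
              gcongr
              rw [Real.exp_le_one_iff, neg_nonpos]
              positivity
          _ ≤ ((2 : ℝ) ^ k)⁻¹ := by rw [mul_one]; gcongr
    _ < ∞ := by
        rw [setLIntegral_const]
        refine ENNReal.mul_lt_top ENNReal.ofReal_lt_top ?_
        rw [layer, Measure.prod_prod]
        refine ENNReal.mul_lt_top (measure_lt_top a _) ?_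
        exact (Measure.restrict_apply_le _ _).trans_lt measure_Ioc_lt_top

/-- The measure `A ↦ ∫_A ∫ s N(dx, ds)` of a configuration `N` of locations and jump sizes. -/
def jumpMeasure {X : Type*} [MeasurableSpace X] (N : Measure (X × ℝ)) : Measure X :=
  (N.withDensity fun p => ENNReal.ofReal p.2).map Prod.fst

/-- Law of the completely random measure `U(A) = ∫_A ∫_0^∞ s N(dx, ds)` without fixed atoms, for
`N` a Poisson process with intensity `s⁻¹ e^{-s c(x)} ds a(dx)`. -/
def crmLaw {X : Type*} [MeasurableSpace X] (a : Measure X) [IsFiniteMeasure a] (c : X → ℝ≥0) :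
    Measure (Measure X) :=
  (poissonLaw (intensity a c) (layer X)).map jumpMeasure

/-- `U / U(𝔛)`, the normalisation of a measure with `0 < U(𝔛) < ∞`. -/
def normalise {X : Type*} [MeasurableSpace X] (U : Measure X) : Measure X :=
  (U Set.univ)⁻¹ • U

/-- The extended gamma prior: law of the normalised extended gamma completely random measure. -/
def prior {X : Type*} [MeasurableSpace X] (a : Measure X) [IsFiniteMeasure a] (b : X → ℝ≥0) :
    Measure (Measure X) :=
  (crmLaw a b).map normalise

/-! ### Posterior distributions -/

/-- `post` is (a version of) the posterior distribution of a random probability measure `P` with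
law `Π`, given `X₁, …, X_n` that are, given `P`, i.i.d. with law `P`: it is a Markov kernel, and
the joint law `Pr(P ∈ C, X₁ ∈ B₁, …, X_n ∈ B_n) = ∫_C ∏ᵢ P(Bᵢ) Π(dP)` is obtained
by integrating `post` with respect to the marginal law `M` of `(X₁, …, X_n)`. -/
def IsPosterior {X : Type*} [MeasurableSpace X] (Pri : Measure (Measure X)) (n : ℕ)
    (post : (Fin n → X) → Measure (Measure X)) : Prop :=
  Measurable post ∧ (∀ x, IsProbabilityMeasure (post x)) ∧
    ∃ M : Measure (Fin n → X),
      (∀ B : Fin n → Set X, (∀ i, MeasurableSet (B i)) →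
        M (Set.univ.pi B) = ∫⁻ P, ∏ i, P (B i) ∂Pri) ∧
      ∀ C : Set (Measure X), MeasurableSet C →
        ∀ B : Fin n → Set X, (∀ i, MeasurableSet (B i)) →
          ∫⁻ P in C, ∏ i, P (B i) ∂Pri = ∫⁻ x in Set.univ.pi B, post x C ∂M

/-- `ψ(l) = ∫ ∫_0^∞ (1 - e^{-l s}) s⁻¹ e^{-s b(x)} ds a(dx)`. -/
def psi {X : Type*} [MeasurableSpace X] (a : Measure X) (b : X → ℝ≥0) (l : ℝ) : ℝ :=
  (∫⁻ p, ENNReal.ofReal (1 - Real.exp (-(l * p.2))) ∂(intensity a b)).toReal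

/-- The measure on `(0,∞)` with Lebesgue density `l^{n-1} e^{-ψ(l)} ∏ᵢ (l + b(xᵢ))⁻¹` (`n ≥ 1`). -/
def mixingWeight {X : Type*} [MeasurableSpace X] (a : Measure X) (b : X → ℝ≥0) {n : ℕ}
    (x : Fin n → X) : Measure ℝ :=
  (volume.restrict (Set.Ioi (0 : ℝ))).withDensity fun l =>
    ENNReal.ofReal (l ^ (n - 1) * Real.exp (-psi a b l) * ∏ i, (l + (b (x i) : ℝ))⁻¹)

/-- The mixing distribution of `Λ` given the observations: `mixingWeight`, normalised. -/
def mixingLaw {X : Type*} [MeasurableSpace X] (a : Measure X) (b : X → ℝ≥0) {n : ℕ}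
    (x : Fin n → X) : Measure ℝ :=
  (mixingWeight a b x Set.univ)⁻¹ • mixingWeight a b x

/-- The standard version of the posterior distribution given observations `x₁, …, x_n`:
the law of `(Ψ + ∑ᵢ Wᵢ δ_{xᵢ}) / (Ψ(𝔛) + ∑ᵢ Wᵢ)`, where `Λ` follows the mixing distribution and,
given `Λ = l`, the completely random measure `Ψ` has intensity `s⁻¹ e^{-s(l + b(x))} ds a(dx)` and
no fixed atoms, the `Wᵢ` are exponential with rates `l + b(xᵢ)`, and all these are independent. -/
def posterior {X : Type*} [MeasurableSpace X] (a : Measure X) [IsFiniteMeasure a] (b : X → ℝ≥0)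
    {n : ℕ} (x : Fin n → X) : Measure (Measure X) :=
  (mixingLaw a b x).bind fun l =>
    ((crmLaw a fun y => l.toNNReal + b y).prod
        (Measure.pi fun i => expMeasure (l + (b (x i) : ℝ)))).map
      fun p => normalise (p.1 + ∑ i, ENNReal.ofReal (p.2 i) • Measure.dirac (x i))

/-- The empirical distribution `n⁻¹ ∑ᵢ δ_{xᵢ}`. -/
def empirical {X : Type*} [MeasurableSpace X] {n : ℕ} (x : Fin n → X) : Measure X :=
  (n : ℝ≥0∞)⁻¹ • ∑ i, Measure.dirac (x i)

end ExtGamma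

end

/-!
Write `Q` for the law of the completely random measure `U` and `P = U / U(𝔛)`.

*Posterior.* For points `x₁, …, xₙ` let `S_x` (`augmentedLaw`) be the image of
`Q ⊗ ⨂ᵢ e^{-b(xᵢ)w} dw` under `(U, w) ↦ V = U + ∑ᵢ wᵢ δ_{xᵢ}`. The Mecke formula for Poisson
processes gives `E_Q[U(A) G(U)] = ∫_A S_y(G) a(dy)`: the factor `s` of size-biasing cancels the
`s⁻¹` of the intensity. Size-biasing one of the `wᵢ` adds an independent copy of it, that is, one
more observation at `xᵢ`. Together these give `S_x(V(A) G) = ∫_A S_{y,x}(G) (a + ∑ᵢ δ_{xᵢ})(dy)`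
(`lintegral_augmentedLaw_mecke`). By induction, with no discussion of ties among the observations,
`E_Q[∏ᵢ U(Bᵢ) G(U)] = ∫_{B₁ × ⋯ × Bₙ} S_x(G) μₙ(dx)` (`lintegral_crmLaw_prod`), where `μₙ` is the
unnormalised law of `n` draws from the Pólya urn started at `a`. For `G(U) = U(𝔛)^{-n} 1_C(P)` this
says that the posterior law is the law of `V / V(𝔛)` under `V(𝔛)^{-n} S_x`, normalised.

To recognise the stated posterior, write `Γ(n) V(𝔛)^{-n} = ∫_0^∞ l^{n-1} e^{-l V(𝔛)} dl`. Tilting by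
`e^{-l V(𝔛)}` raises the rates of the intensity and of the exponential variables by `l`, and costs
the factor `e^{-ψ(l)} ∏ᵢ (l + b(xᵢ))⁻¹` (`prod_crmLaw_expMeasure_eq_withDensity`); so `l` is
distributed as `Λ`. The tilting of an infinite superposition of Poisson processes is checked on
boxes, as a limit of finite products. The normalising constant is finite at every `x`: for `n = 1`
it integrates to `E P(𝔛) = 1`, hence is finite somewhere, and the mixing densities are comparable.

*Posterior mean.* By the same formula `E Pₙ(A) = ∫_A κ(y) (a + ∑ᵢ δ_{xᵢ})(dy)`, where `κ(y)` is the
ratio of the normalising constants for the observations `(y, x)` and `x`. Since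
`l / (l + b(y)) ≤ 1`, `κ ≤ 1 / n`, and therefore `E Pₙ(A) ≤ ℙₙ(A) + a(𝔛) / n`. The same bound for
the complement of `A` yields the lower bound, so the distance is at most `a(𝔛) / n` along every
sequence of observations.
-/

noncomputable section

namespace ExtGamma

/-! ### The decreasing exponential on extended nonnegative numbers -/

/-- `e^{-u}` for `u ∈ [0,∞]`, with value `0` at `u = ∞`. -/
def expNeg (u : ℝ≥0∞) : ℝ≥0∞ := (EReal.exp (u : EReal))⁻¹

theorem expNeg_zero : expNeg 0 = 1 := by simp [expNeg]

theorem expNeg_add (u v : ℝ≥0∞) : expNeg (u + v) = expNeg u * expNeg v := by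
  rw [expNeg, EReal.coe_ennreal_add, EReal.exp_add, ENNReal.mul_inv, expNeg, expNeg]
  · left; rw [Ne, EReal.exp_eq_zero_iff]; exact EReal.coe_ennreal_ne_bot u
  · right; rw [Ne, EReal.exp_eq_zero_iff]; exact EReal.coe_ennreal_ne_bot v

theorem expNeg_ofReal {x : ℝ} (hx : 0 ≤ x) :
    expNeg (ENNReal.ofReal x) = ENNReal.ofReal (Real.exp (-x)) := by
  rw [expNeg, EReal.coe_ennreal_ofReal, max_eq_left hx, EReal.exp_coe, Real.exp_neg,
    ENNReal.ofReal_inv_of_pos (Real.exp_pos x)]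

theorem continuous_expNeg : Continuous expNeg :=
  continuous_inv.comp (ENNReal.continuous_exp.comp continuous_coe_ennreal_ereal)

@[fun_prop]
theorem measurable_expNeg : Measurable expNeg := continuous_expNeg.measurable

theorem expNeg_le_one (u : ℝ≥0∞) : expNeg u ≤ 1 := by
  rw [expNeg, ENNReal.inv_le_one, EReal.one_le_exp_iff]
  exact EReal.coe_ennreal_nonneg u

theorem expNeg_ne_zero {u : ℝ≥0∞} (hu : u ≠ ∞) : expNeg u ≠ 0 := by
  rw [expNeg, Ne, ENNReal.inv_eq_zero, EReal.exp_eq_top_iff]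
  simpa using hu

theorem expNeg_top : expNeg ∞ = 0 := by simp [expNeg]

theorem expNeg_ne_top (u : ℝ≥0∞) : expNeg u ≠ ∞ :=
  ((expNeg_le_one u).trans_lt ENNReal.one_lt_top).ne

theorem expNeg_sum {ι : Type*} (s : Finset ι) (u : ι → ℝ≥0∞) :
    expNeg (∑ i ∈ s, u i) = ∏ i ∈ s, expNeg (u i) := by
  classical
  induction s using Finset.induction_on with
  | empty => simp [expNeg_zero]
  | insert i s hi ih => rw [Finset.sum_insert hi, Finset.prod_insert hi, expNeg_add, ih]

/-! ### Measurability of operations on measures -/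

section Measurability

variable {E Y : Type*} [MeasurableSpace E] [MeasurableSpace Y]

theorem measurable_measure_apply {f : Y → Measure E} (hf : Measurable f) {s : Set E}
    (hs : MeasurableSet s) : Measurable fun y => f y s :=
  (Measure.measurable_coe hs).comp hf

theorem measurable_smul_measure {f : Y → Measure E} {c : Y → ℝ≥0∞} (hc : Measurable c)
    (hf : Measurable f) : Measurable fun y => c y • f y := by
  refine Measure.measurable_of_measurable_coe _ fun s hs => ?_
  simp only [Measure.smul_apply, smul_eq_mul]
  exact hc.mul (measurable_measure_apply hf hs)

theorem measurable_finsetSum_measure {ι : Type*} (t : Finset ι) {f : ι → Y → Measure E}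
    (hf : ∀ i ∈ t, Measurable (f i)) : Measurable fun y => ∑ i ∈ t, f i y := by
  refine Measure.measurable_of_measurable_coe _ fun s hs => ?_
  simp only [Measure.coe_finsetSum, Finset.sum_apply]
  exact Finset.measurable_sum _ fun i hi => measurable_measure_apply (hf i hi) hs

theorem measurable_measureSum {ι : Type*} [Countable ι] :
    Measurable (Measure.sum : (ι → Measure E) → Measure E) := by
  refine Measure.measurable_of_measurable_coe _ fun s hs => ?_
  simp only [Measure.sum_apply _ hs]
  exact Measurable.tsum fun i => (Measure.measurable_coe hs).comp (measurable_pi_apply i)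

theorem measurable_normalise : Measurable (normalise : Measure E → Measure E) :=
  measurable_smul_measure (Measure.measurable_coe MeasurableSet.univ).inv measurable_id

end Measurability

/-! ### Finite products -/

theorem lintegral_pi_fin_succ {E : Type*} [MeasurableSpace E] {n : ℕ}
    (μ : Fin (n + 1) → Measure E) [∀ i, SigmaFinite (μ i)] (j : Fin (n + 1))
    {f : E × (Fin n → E) → ℝ≥0∞} (hf : Measurable f) :
    ∫⁻ y, f (y j, fun i => y (j.succAbove i)) ∂Measure.pi μ =
      ∫⁻ z, ∫⁻ y, f (z, y) ∂(Measure.pi fun i => μ (j.succAbove i)) ∂(μ j) := by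
  rw [← lintegral_prod _ hf.aemeasurable,
    ← (measurePreserving_piFinSuccAbove μ j).lintegral_comp hf]
  rfl

theorem lintegral_pi_prod {E : Type*} [MeasurableSpace E] {n : ℕ} (μ : Fin n → Measure E)
    [∀ i, SigmaFinite (μ i)] {f : Fin n → E → ℝ≥0∞} (hf : ∀ i, Measurable (f i)) :
    ∫⁻ y, ∏ i, f i (y i) ∂Measure.pi μ = ∏ i, ∫⁻ z, f i z ∂μ i := by
  induction n with
  | zero => simp
  | succ n ih =>
    have hF : Measurable fun p : E × (Fin n → E) => f 0 p.1 * ∏ i, f i.succ (p.2 i) :=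
      ((hf 0).comp measurable_fst).mul (Finset.measurable_prod _ fun (i : Fin n) _ =>
        (hf i.succ).comp ((measurable_pi_apply i).comp measurable_snd))
    have h := lintegral_pi_fin_succ μ 0 hF
    simp only [Fin.succAbove_zero] at h
    simp_rw [Fin.prod_univ_succ]
    rw [h]
    have h2 : ∀ z, ∫⁻ y, f 0 z * ∏ i : Fin n, f i.succ (y i)
          ∂(Measure.pi fun i : Fin n => μ i.succ) =
        f 0 z * ∏ i : Fin n, ∫⁻ z, f i.succ z ∂μ i.succ := by
      intro z
      have hm : Measurable fun y : Fin n → E => ∏ i : Fin n, f i.succ (y i) :=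
        Finset.measurable_prod _ fun i _ => (hf i.succ).comp (measurable_pi_apply i)
      rw [lintegral_const_mul _ hm, ih (fun i : Fin n => μ i.succ) fun i => hf i.succ]
    simp_rw [h2]
    rw [lintegral_mul_const _ (hf 0)]

theorem pi_withDensity {E : Type*} [MeasurableSpace E] {n : ℕ} (μ : Fin n → Measure E)
    [∀ i, SigmaFinite (μ i)] {f : Fin n → E → ℝ≥0∞} (hf : ∀ i, Measurable (f i))
    [∀ i, SigmaFinite ((μ i).withDensity (f i))] :
    (Measure.pi fun i => (μ i).withDensity (f i)) =
      (Measure.pi μ).withDensity fun y => ∏ i, f i (y i) := by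
  refine Measure.pi_eq fun s hs => ?_
  rw [withDensity_apply _ (MeasurableSet.univ_pi hs),
    ← lintegral_indicator (MeasurableSet.univ_pi hs)]
  have h : ∀ y : Fin n → E, (Set.univ.pi s).indicator (fun y => ∏ i, f i (y i)) y =
      ∏ i, (s i).indicator (f i) (y i) := by
    intro y
    by_cases hy : y ∈ Set.univ.pi s
    · rw [Set.indicator_of_mem hy]
      exact Finset.prod_congr rfl fun i _ => (Set.indicator_of_mem (hy i trivial) _).symm
    · rw [Set.indicator_of_notMem hy]
      simp only [Set.mem_pi, not_forall] at hy
      obtain ⟨i, -, hi⟩ := hy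
      exact (Finset.prod_eq_zero (Finset.mem_univ i) (Set.indicator_of_notMem hi _)).symm
  simp_rw [h]
  rw [lintegral_pi_prod μ fun i => (hf i).indicator (hs i)]
  exact Finset.prod_congr rfl fun i _ => by
    rw [lintegral_indicator (hs i), withDensity_apply _ (hs i)]

theorem pi_smul {E : Type*} [MeasurableSpace E] {n : ℕ} (μ : Fin n → Measure E)
    [∀ i, SigmaFinite (μ i)] (c : Fin n → ℝ≥0∞) [∀ i, SigmaFinite (c i • μ i)] :
    (Measure.pi fun i => c i • μ i) = (∏ i, c i) • Measure.pi μ := by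
  refine Measure.pi_eq fun s _ => ?_
  simp [Measure.pi_pi, Finset.prod_mul_distrib]

/-! ### Infinite products -/

section InfinitePi

variable {ι : Type*} {F : ι → Type*} [∀ k, MeasurableSpace (F k)]
  (P : ∀ k, Measure (F k)) [∀ k, IsProbabilityMeasure (P k)]

theorem measurable_update_prod [DecidableEq ι] (k : ι) :
    Measurable fun p : (∀ k, F k) × F k => Function.update p.1 k p.2 := by
  refine measurable_pi_lambda _ fun j => ?_
  by_cases h : j = k
  · subst h; simpa using measurable_snd
  · simp only [Function.update_of_ne h]
    fun_prop

/-- Resampling one coordinate of a product measure does not change it. -/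
theorem infinitePi_map_update [DecidableEq ι] (k : ι) :
    ((Measure.infinitePi P).prod (P k)).map (fun p => Function.update p.1 k p.2) =
      Measure.infinitePi P := by
  refine Measure.eq_infinitePi P fun s t ht => ?_
  rw [Measure.map_apply (measurable_update_prod k)
    (MeasurableSet.pi s.countable_toSet fun i _ => ht i)]
  by_cases hk : k ∈ s
  · have : (fun p : (∀ k, F k) × F k => Function.update p.1 k p.2) ⁻¹' (Set.pi s t) =
        (Set.pi (s.erase k : Finset ι) t) ×ˢ (t k) := by
      ext ⟨N, M⟩
      simp only [Set.mem_preimage, Set.mem_pi, Finset.mem_coe, Set.mem_prod, Finset.mem_erase]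
      constructor
      · intro h
        exact ⟨fun i hi => by simpa [Function.update_of_ne hi.1] using h i hi.2,
          by simpa using h k hk⟩
      · rintro ⟨h1, h2⟩ i hi
        by_cases hik : i = k
        · subst hik; simpa using h2
        · simpa [Function.update_of_ne hik] using h1 i ⟨hik, hi⟩
    rw [this, Measure.prod_prod, Measure.infinitePi_pi P fun i _ => ht i,
      Finset.prod_erase_mul _ _ hk]
  · have : (fun p : (∀ k, F k) × F k => Function.update p.1 k p.2) ⁻¹' (Set.pi s t) =
        (Set.pi s t) ×ˢ Set.univ := by
      ext ⟨N, M⟩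
      simp only [Set.mem_preimage, Set.mem_pi, Finset.mem_coe, Set.mem_prod, Set.mem_univ, and_true]
      refine forall₂_congr fun i hi => ?_
      rw [Function.update_of_ne (fun h : i = k => hk (h ▸ hi))]
    rw [this, Measure.prod_prod, Measure.infinitePi_pi P fun i _ => ht i, measure_univ, mul_one]

theorem lintegral_infinitePi_update [DecidableEq ι] (k : ι) {f : (∀ k, F k) → ℝ≥0∞}
    (hf : Measurable f) :
    ∫⁻ N, f N ∂Measure.infinitePi P =
      ∫⁻ N, ∫⁻ M, f (Function.update N k M) ∂P k ∂Measure.infinitePi P := by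
  conv_lhs => rw [← infinitePi_map_update P k]
  rw [lintegral_map hf (measurable_update_prod k),
    lintegral_prod (fun p => f (Function.update p.1 k p.2))
      (hf.comp (measurable_update_prod k)).aemeasurable]

theorem lintegral_infinitePi_prod (s : Finset ι) {f : ∀ k, F k → ℝ≥0∞}
    (hf : ∀ k, Measurable (f k)) :
    ∫⁻ N, ∏ k ∈ s, f k (N k) ∂Measure.infinitePi P = ∏ k ∈ s, ∫⁻ M, f k M ∂P k := by
  have hi : iIndepFun (fun k (N : ∀ k, F k) => f k (N k)) (Measure.infinitePi P) :=
    iIndepFun_infinitePi (P := P) (X := f) hf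
  have h := lintegral_prod_eq_prod_lintegral_of_indepFun s _ hi
    fun k => (hf k).comp (measurable_pi_apply k)
  rw [h]
  refine Finset.prod_congr rfl fun k _ => ?_
  rw [← lintegral_map (hf k) (measurable_pi_apply k), Measure.infinitePi_map_eval]

variable [Countable ι] {P} {P' : ∀ k, Measure (F k)} [∀ k, IsProbabilityMeasure (P' k)]
  {g : ∀ k, F k → ℝ≥0∞} {d : ι → ℝ≥0∞}

/-- Exponential tilting of a product measure, evaluated on boxes: only finitely many coordinates
are restricted by a box, so the infinite product of tilts is a limit of finite ones. -/
theorem setLIntegral_infinitePi_expNeg (hg : ∀ k, Measurable (g k))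
    (h : ∀ k, (P k).withDensity (fun M => expNeg (g k M)) = expNeg (d k) • P' k)
    (s : Finset ι) {t : ∀ k, Set (F k)} (ht : ∀ k, MeasurableSet (t k)) :
    ∫⁻ N in Set.pi s t, expNeg (∑' k, g k (N k)) ∂Measure.infinitePi P =
      expNeg (∑' k, d k) * ∏ k ∈ s, P' k (t k) := by
  classical
  have hbox : MeasurableSet (Set.pi (s : Set ι) t) :=
    MeasurableSet.pi s.countable_toSet fun i _ => ht i
  have lim1 : Tendsto (fun S : Finset ι => ∫⁻ N in Set.pi s t, expNeg (∑ k ∈ S, g k (N k))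
      ∂Measure.infinitePi P) atTop
      (nhds (∫⁻ N in Set.pi s t, expNeg (∑' k, g k (N k)) ∂Measure.infinitePi P)) := by
    refine tendsto_lintegral_filter_of_dominated_convergence (fun _ => 1)
      (Eventually.of_forall fun S => ?_)
      (Eventually.of_forall fun S => ae_of_all _ fun N => expNeg_le_one _) ?_
      (ae_of_all _ fun N => ?_)
    · exact measurable_expNeg.comp (Finset.measurable_sum _ fun k _ =>
        (hg k).comp (measurable_pi_apply k))
    · simp
    · exact (continuous_expNeg.tendsto _).comp ENNReal.summable.hasSum
  have lim2 : Tendsto (fun S : Finset ι => expNeg (∑ k ∈ S, d k) * ∏ k ∈ s, P' k (t k)) atTop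
      (nhds (expNeg (∑' k, d k) * ∏ k ∈ s, P' k (t k))) := by
    refine ENNReal.Tendsto.mul_const ((continuous_expNeg.tendsto _).comp
      ENNReal.summable.hasSum) (Or.inr ?_)
    exact ENNReal.prod_ne_top fun k _ => measure_ne_top _ _
  refine tendsto_nhds_unique lim1 (lim2.congr' ?_)
  -- once `S ⊇ s`, the integrand is a product over `S` of functions of single coordinates
  filter_upwards [eventually_ge_atTop s] with S hS
  set t' : ∀ k, Set (F k) := fun k => if k ∈ s then t k else Set.univ with ht'
  have ht'm : ∀ k, MeasurableSet (t' k) := fun k => by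
    by_cases hk : k ∈ s <;> simp [ht', hk, ht k]
  have e1 : ∀ N : ∀ k, F k, (Set.pi (s : Set ι) t).indicator
      (fun N => expNeg (∑ k ∈ S, g k (N k))) N =
      ∏ k ∈ S, (t' k).indicator (fun M => expNeg (g k M)) (N k) := by
    intro N
    by_cases hN : N ∈ Set.pi (s : Set ι) t
    · rw [Set.indicator_of_mem hN, expNeg_sum]
      refine Finset.prod_congr rfl fun k _ => ?_
      rw [Set.indicator_of_mem]
      by_cases hk : k ∈ s
      · simpa [ht', hk] using hN k hk
      · simp [ht', hk]
    · rw [Set.indicator_of_notMem hN]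
      simp only [Set.mem_pi, not_forall] at hN
      obtain ⟨k, hk, hkN⟩ := hN
      have hk' : k ∈ s := hk
      refine (Finset.prod_eq_zero (hS hk') ?_).symm
      rw [Set.indicator_of_notMem]
      simpa [ht', hk'] using hkN
  rw [← lintegral_indicator hbox]
  simp_rw [e1]
  rw [lintegral_infinitePi_prod P S (f := fun k => (t' k).indicator fun M => expNeg (g k M))
    fun k => (measurable_expNeg.comp (hg k)).indicator (ht'm k)]
  have e2 : ∀ k, ∫⁻ M, (t' k).indicator (fun M => expNeg (g k M)) M ∂P k =
      expNeg (d k) * P' k (t' k) := by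
    intro k
    rw [lintegral_indicator (ht'm k), ← withDensity_apply _ (ht'm k), h k]
    simp
  simp_rw [e2]
  rw [Finset.prod_mul_distrib, expNeg_sum]
  congr 1
  rw [← Finset.prod_subset hS]
  · exact Finset.prod_congr rfl fun k hk => by simp [ht', hk]
  · intro k _ hk
    simp [ht', hk]

theorem lintegral_infinitePi_expNeg (hg : ∀ k, Measurable (g k))
    (h : ∀ k, (P k).withDensity (fun M => expNeg (g k M)) = expNeg (d k) • P' k) :
    ∫⁻ N, expNeg (∑' k, g k (N k)) ∂Measure.infinitePi P = expNeg (∑' k, d k) := by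
  have := setLIntegral_infinitePi_expNeg hg h ∅ (fun _ => MeasurableSet.univ)
  simpa using this

theorem infinitePi_withDensity_expNeg (hg : ∀ k, Measurable (g k))
    (h : ∀ k, (P k).withDensity (fun M => expNeg (g k M)) = expNeg (d k) • P' k)
    (hd : ∑' k, d k ≠ ∞) :
    (Measure.infinitePi P).withDensity (fun N => expNeg (∑' k, g k (N k))) =
      expNeg (∑' k, d k) • Measure.infinitePi P' := by
  have h0 := expNeg_ne_zero hd
  have h1 := expNeg_ne_top (∑' k, d k)
  rw [← Measure.eq_infinitePi P' (ν := (expNeg (∑' k, d k))⁻¹ •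
    (Measure.infinitePi P).withDensity (fun N => expNeg (∑' k, g k (N k))))]
  · rw [smul_smul, ENNReal.mul_inv_cancel h0 h1, one_smul]
  · intro s t ht
    rw [Measure.smul_apply, withDensity_apply _
      (MeasurableSet.pi s.countable_toSet fun i _ => ht i),
      setLIntegral_infinitePi_expNeg hg h s ht, smul_eq_mul, ← mul_assoc,
      ENNReal.inv_mul_cancel h0 h1, one_mul]

end InfinitePi

/-! ### Poisson processes: Mecke formula and exponential tilting -/

section Poisson

variable {E : Type*} [MeasurableSpace E]

theorem lintegral_finitePoissonLaw (m : Measure E) {F : Measure E → ℝ≥0∞} (hF : Measurable F) :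
    ∫⁻ N, F N ∂finitePoissonLaw m = ENNReal.ofReal (Real.exp (-(m Set.univ).toReal)) *
      ∑' k : ℕ, ((k ! : ℕ) : ℝ≥0∞)⁻¹ *
        ∫⁻ y, F (∑ i, Measure.dirac (y i)) ∂(Measure.pi fun _ : Fin k => m) := by
  rw [finitePoissonLaw, lintegral_smul_measure, lintegral_sum_measure, smul_eq_mul]
  congr 2 with k
  rw [lintegral_smul_measure, lintegral_map hF (measurable_sum_dirac k), smul_eq_mul]

theorem measurable_add_dirac {F : Measure E → ℝ≥0∞} (hF : Measurable F) :
    Measurable fun p : E × Measure E => F (p.2 + Measure.dirac p.1) :=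
  hF.comp (measurable_snd.add (Measure.measurable_dirac.comp measurable_fst))

theorem measurable_sum_dirac_add {F : Measure E → ℝ≥0∞} (hF : Measurable F) (k : ℕ) :
    Measurable fun p : E × (Fin k → E) => F (∑ i, Measure.dirac (p.2 i) + Measure.dirac p.1) :=
  (measurable_add_dirac hF).comp
    (measurable_fst.prodMk ((measurable_sum_dirac k).comp measurable_snd))

/-- The Mecke formula for the sum of the point masses at `k + 1` i.i.d. points: by symmetry each
point contributes the same amount. -/
theorem lintegral_pi_mecke (m : Measure E) [IsFiniteMeasure m] {f : E → ℝ≥0∞}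
    (hf : Measurable f) {F : Measure E → ℝ≥0∞} (hF : Measurable F) (k : ℕ) :
    ∫⁻ y, (∫⁻ z, f z ∂(∑ i, Measure.dirac (y i))) * F (∑ i, Measure.dirac (y i))
      ∂(Measure.pi fun _ : Fin (k + 1) => m) =
      ((k + 1 : ℕ) : ℝ≥0∞) * ∫⁻ z, f z * ∫⁻ y, F (∑ i, Measure.dirac (y i) + Measure.dirac z)
        ∂(Measure.pi fun _ : Fin k => m) ∂m := by
  have h1 : ∀ y : Fin (k + 1) → E, (∫⁻ z, f z ∂(∑ i, Measure.dirac (y i))) *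
      F (∑ i, Measure.dirac (y i)) =
      ∑ j, f (y j) * F (∑ i, Measure.dirac (y (j.succAbove i)) + Measure.dirac (y j)) := by
    intro y
    rw [lintegral_finsetSum_measure, Finset.sum_mul]
    refine Finset.sum_congr rfl fun j _ => ?_
    rw [lintegral_dirac' _ hf, Fin.sum_univ_succAbove _ j, add_comm (Measure.dirac (y j))]
  simp_rw [h1]
  have h0 : Measurable fun p : E × (Fin k → E) =>
      f p.1 * F (∑ i, Measure.dirac (p.2 i) + Measure.dirac p.1) :=
    (hf.comp measurable_fst).mul (measurable_sum_dirac_add hF k)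
  have h2 : ∀ j : Fin (k + 1), Measurable fun y : Fin (k + 1) → E =>
      f (y j) * F (∑ i, Measure.dirac (y (j.succAbove i)) + Measure.dirac (y j)) := by
    intro j
    have hsplit : Measurable fun y : Fin (k + 1) → E =>
        ((y j, fun i => y (j.succAbove i)) : E × (Fin k → E)) := by fun_prop
    exact h0.comp hsplit
  rw [lintegral_finsetSum _ fun j _ => h2 j]
  have h3 : ∀ j : Fin (k + 1), ∫⁻ y, f (y j) *
      F (∑ i, Measure.dirac (y (j.succAbove i)) + Measure.dirac (y j))
        ∂(Measure.pi fun _ : Fin (k + 1) => m) =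
      ∫⁻ z, f z * ∫⁻ y, F (∑ i, Measure.dirac (y i) + Measure.dirac z)
        ∂(Measure.pi fun _ : Fin k => m) ∂m := by
    intro j
    rw [lintegral_pi_fin_succ (fun _ : Fin (k + 1) => m) j h0]
    refine lintegral_congr fun z => ?_
    have hz := (measurable_sum_dirac_add hF k).comp (measurable_prodMk_left (x := z))
    exact lintegral_const_mul (f z) hz
  simp_rw [h3]
  simp

/-- The Mecke formula for a Poisson process with finite intensity. -/
theorem lintegral_finitePoissonLaw_mecke (m : Measure E) [IsFiniteMeasure m] {f : E → ℝ≥0∞}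
    (hf : Measurable f) {F : Measure E → ℝ≥0∞} (hF : Measurable F) :
    ∫⁻ N, (∫⁻ z, f z ∂N) * F N ∂finitePoissonLaw m =
      ∫⁻ z, f z * ∫⁻ N, F (N + Measure.dirac z) ∂finitePoissonLaw m ∂m := by
  have hmeas : ∀ k : ℕ, Measurable fun z : E => f z * ∫⁻ y, F (∑ i, Measure.dirac (y i) +
      Measure.dirac z) ∂(Measure.pi fun _ : Fin k => m) := fun k =>
    hf.mul (measurable_sum_dirac_add hF k).lintegral_prod_right'
  have hfF : Measurable fun N : Measure E => (∫⁻ z, f z ∂N) * F N :=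
    (Measure.measurable_lintegral hf).mul hF
  have hR : ∀ z, f z * ∫⁻ N, F (N + Measure.dirac z) ∂finitePoissonLaw m =
      ∑' k : ℕ, ENNReal.ofReal (Real.exp (-(m Set.univ).toReal)) * (((k ! : ℕ) : ℝ≥0∞)⁻¹ *
        (f z * ∫⁻ y, F (∑ i, Measure.dirac (y i) + Measure.dirac z)
          ∂(Measure.pi fun _ : Fin k => m))) := by
    intro z
    have hz : Measurable fun N : Measure E => F (N + Measure.dirac z) :=
      (measurable_add_dirac hF).comp measurable_prodMk_left
    rw [lintegral_finitePoissonLaw m hz, ← ENNReal.tsum_mul_left, ← ENNReal.tsum_mul_left]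
    refine tsum_congr fun k => ?_
    ring
  simp_rw [hR]
  -- the term of a process without points vanishes on the left; shifting the index turns the factor
  -- `(k + 1) / (k + 1)!` into `1 / k!`
  rw [lintegral_finitePoissonLaw m hfF, tsum_eq_zero_add' ENNReal.summable,
    lintegral_tsum fun k => (((hmeas k).const_mul _).const_mul _).aemeasurable]
  simp_rw [lintegral_pi_mecke m hf hF]
  simp only [Finset.univ_eq_empty, Finset.sum_empty, lintegral_zero_measure, zero_mul,
    lintegral_zero, mul_zero, zero_add]
  rw [← ENNReal.tsum_mul_left]
  refine tsum_congr fun k => ?_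
  rw [lintegral_const_mul _ ((hmeas k).const_mul _), lintegral_const_mul _ (hmeas k), ← mul_assoc _
    ((k + 1 : ℕ) : ℝ≥0∞)]
  congr 2
  rw [Nat.factorial_succ, Nat.cast_mul, ENNReal.mul_inv (by simp) (by simp), mul_right_comm,
    ENNReal.inv_mul_cancel (by simp) (by simp), one_mul]

/-- Exponential tilting by `e^{-N(g)}` turns a Poisson process with finite intensity `m` into one
with intensity `e^{-g} m`, up to the normalising constant. -/
theorem finitePoissonLaw_withDensity_expNeg (m : Measure E) [IsFiniteMeasure m] {g : E → ℝ≥0∞}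
    (hg : Measurable g) :
    (finitePoissonLaw m).withDensity (fun N => expNeg (∫⁻ z, g z ∂N)) =
      expNeg (∫⁻ z, (1 - expNeg (g z)) ∂m) •
        finitePoissonLaw (m.withDensity fun z => expNeg (g z)) := by
  have heg : Measurable fun z => expNeg (g z) := measurable_expNeg.comp hg
  set m' := m.withDensity fun z => expNeg (g z) with hm'
  have hm'u : m' Set.univ = ∫⁻ z, expNeg (g z) ∂m := by
    rw [hm', withDensity_apply _ MeasurableSet.univ, Measure.restrict_univ]
  have hm'le : m' Set.univ ≤ m Set.univ := by
    rw [hm'u, ← lintegral_one]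
    exact lintegral_mono fun z => expNeg_le_one _
  have : IsFiniteMeasure m' := ⟨hm'le.trans_lt (measure_lt_top _ _)⟩
  have hmass : m Set.univ = (∫⁻ z, (1 - expNeg (g z)) ∂m) + m' Set.univ := by
    rw [hm'u, ← lintegral_add_right _ heg, ← lintegral_one]
    exact lintegral_congr fun z => (tsub_add_cancel_of_le (expNeg_le_one _)).symm
  have hexp : ∀ (ν : Measure E) [IsFiniteMeasure ν],
      ENNReal.ofReal (Real.exp (-(ν Set.univ).toReal)) = expNeg (ν Set.univ) := fun ν _ => by
    rw [← expNeg_ofReal ENNReal.toReal_nonneg, ENNReal.ofReal_toReal (measure_ne_top _ _)]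
  have hH : Measurable fun N : Measure E => expNeg (∫⁻ z, g z ∂N) :=
    measurable_expNeg.comp (Measure.measurable_lintegral hg)
  ext s hs
  have hind : Measurable (s.indicator (1 : Measure E → ℝ≥0∞)) := measurable_one.indicator hs
  rw [← lintegral_indicator_one hs, lintegral_withDensity_eq_lintegral_mul _ hH hind,
    Measure.smul_apply, ← lintegral_indicator_one hs, smul_eq_mul]
  rw [lintegral_finitePoissonLaw _ (hH.mul hind), lintegral_finitePoissonLaw _ hind, hexp m,
    hexp m', ← mul_assoc, ← expNeg_add, ← hmass]
  congr 2 with k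
  congr 1
  have hprod : Measurable fun y : Fin k → E => ∏ i, expNeg (g (y i)) := by fun_prop
  have hindk : Measurable fun y : Fin k → E =>
      s.indicator (1 : Measure E → ℝ≥0∞) (∑ i, Measure.dirac (y i)) :=
    hind.comp (measurable_sum_dirac k)
  rw [hm', pi_withDensity (fun _ : Fin k => m) (f := fun _ z => expNeg (g z)) fun _ => heg,
    lintegral_withDensity_eq_lintegral_mul _ hprod hindk]
  refine lintegral_congr fun y => ?_
  simp only [Pi.mul_apply]
  rw [lintegral_finsetSum_measure, expNeg_sum]
  simp_rw [lintegral_dirac' _ hg]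

theorem sum_update_add {ι : Type*} [DecidableEq ι] (N : ι → Measure E) (k : ι)
    (M M' : Measure E) : Measure.sum (Function.update N k (M + M')) =
      Measure.sum (Function.update N k M) + M' := by
  ext s hs
  have h : ∀ i, Function.update N k (M + M') i s =
      Function.update N k M i s + if i = k then M' s else 0 := by
    intro i
    by_cases hi : i = k
    · subst hi; simp
    · simp [hi]
  rw [Measure.add_apply, Measure.sum_apply _ hs, Measure.sum_apply _ hs]
  simp_rw [h]
  rw [ENNReal.tsum_add, tsum_ite_eq]

variable (ν : Measure E) (S : ℤ → Set E) [∀ k, IsFiniteMeasure (ν.restrict (S k))]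

instance poissonLaw.isProbabilityMeasure : IsProbabilityMeasure (poissonLaw ν S) :=
  Measure.isProbabilityMeasure_map measurable_measureSum.aemeasurable

/-- The Mecke formula. -/
theorem lintegral_poissonLaw_mecke {f : E → ℝ≥0∞} (hf : Measurable f) {F : Measure E → ℝ≥0∞}
    (hF : Measurable F) :
    ∫⁻ N, (∫⁻ z, f z ∂N) * F N ∂poissonLaw ν S =
      ∫⁻ z, f z * ∫⁻ N, F (N + Measure.dirac z) ∂poissonLaw ν S
        ∂(Measure.sum fun k => ν.restrict (S k)) := by
  have hFd : ∀ z, Measurable fun N : Measure E => F (N + Measure.dirac z) := fun z =>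
    (measurable_add_dirac hF).comp (measurable_const.prodMk measurable_id)
  have hfF : Measurable fun N : Measure E => (∫⁻ z, f z ∂N) * F N :=
    (Measure.measurable_lintegral hf).mul hF
  rw [poissonLaw, lintegral_map hfF measurable_measureSum]
  have hmap : ∀ z, ∫⁻ N, F (N + Measure.dirac z) ∂(Measure.infinitePi fun k =>
      finitePoissonLaw (ν.restrict (S k))).map Measure.sum =
      ∫⁻ N, F (Measure.sum N + Measure.dirac z) ∂Measure.infinitePi fun k =>
        finitePoissonLaw (ν.restrict (S k)) := fun z => lintegral_map (hFd z) measurable_measureSum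
  simp_rw [hmap, lintegral_sum_measure, ← ENNReal.tsum_mul_right]
  have hFs : Measurable fun N : ℤ → Measure E => F (Measure.sum N) :=
    hF.comp measurable_measureSum
  rw [lintegral_tsum fun k => by
    exact (((Measure.measurable_lintegral hf).comp (measurable_pi_apply k)).mul hFs).aemeasurable]
  refine tsum_congr fun k => ?_
  -- the process on `S k` is resampled given the others, and the finite Mecke formula applies to it
  set P : ℤ → Measure (Measure E) := fun k => finitePoissonLaw (ν.restrict (S k)) with hP
  have hfk : Measurable fun N : ℤ → Measure E => (∫⁻ z, f z ∂(N k)) * F (Measure.sum N) :=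
    ((Measure.measurable_lintegral hf).comp (measurable_pi_apply k)).mul hFs
  rw [lintegral_infinitePi_update P k hfk]
  have hup : ∀ N : ℤ → Measure E, Measurable fun M : Measure E =>
      F (Measure.sum (Function.update N k M)) := fun N =>
    hFs.comp ((measurable_update_prod k).comp (measurable_prodMk_left (x := N)))
  have hinner : ∀ N : ℤ → Measure E, ∫⁻ M, (∫⁻ z, f z ∂(Function.update N k M k)) *
      F (Measure.sum (Function.update N k M)) ∂P k =
      ∫⁻ z, f z * ∫⁻ M, F (Measure.sum (Function.update N k M) + Measure.dirac z) ∂P k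
        ∂(ν.restrict (S k)) := by
    intro N
    simp only [Function.update_self]
    rw [lintegral_finitePoissonLaw_mecke (ν.restrict (S k)) hf (hup N)]
    simp only [sum_update_add]
    rfl
  simp_rw [hinner]
  have hjoint : Measurable fun p : ((ℤ → Measure E) × E) × Measure E =>
      F (Measure.sum (Function.update p.1.1 k p.2) + Measure.dirac p.1.2) :=
    (measurable_add_dirac hF).comp ((measurable_snd.comp measurable_fst).prodMk
      (measurable_measureSum.comp ((measurable_update_prod k).comp
        ((measurable_fst.comp measurable_fst).prodMk measurable_snd))))
  have hjoint'' : Measurable fun p : (ℤ → Measure E) × E =>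
      ∫⁻ M, F (Measure.sum (Function.update p.1 k M) + Measure.dirac p.2) ∂P k :=
    hjoint.lintegral_prod_right'
  have hjoint' : Measurable fun p : (ℤ → Measure E) × E =>
      f p.2 * ∫⁻ M, F (Measure.sum (Function.update p.1 k M) + Measure.dirac p.2) ∂P k :=
    (hf.comp measurable_snd).mul hjoint''
  rw [lintegral_lintegral_swap hjoint'.aemeasurable]
  refine lintegral_congr fun z => ?_
  have hz := hjoint''.comp (measurable_prodMk_right (y := z))
  refine (lintegral_const_mul (f z) hz).trans ?_
  exact congrArg (f z * ·)
    (lintegral_infinitePi_update P k ((hFd z).comp measurable_measureSum)).symm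

variable {ν S} {ν' : Measure E} [∀ k, IsFiniteMeasure (ν'.restrict (S k))] {g : E → ℝ≥0∞}

theorem lintegral_poissonLaw_expNeg (hg : Measurable g)
    (h : ∀ k, (ν.restrict (S k)).withDensity (fun z => expNeg (g z)) = ν'.restrict (S k)) :
    ∫⁻ N, expNeg (∫⁻ z, g z ∂N) ∂poissonLaw ν S =
      expNeg (∫⁻ z, (1 - expNeg (g z)) ∂(Measure.sum fun k => ν.restrict (S k))) := by
  have hH : Measurable fun N : Measure E => expNeg (∫⁻ z, g z ∂N) :=
    measurable_expNeg.comp (Measure.measurable_lintegral hg)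
  rw [poissonLaw, lintegral_map hH measurable_measureSum]
  simp_rw [lintegral_sum_measure]
  exact lintegral_infinitePi_expNeg (fun k => Measure.measurable_lintegral hg)
    fun k => h k ▸ finitePoissonLaw_withDensity_expNeg _ hg

theorem withDensity_map_comp {α β : Type*} [MeasurableSpace α] [MeasurableSpace β]
    (μ : Measure α) {f : α → β} (hf : Measurable f) {g : β → ℝ≥0∞} (hg : Measurable g) :
    (μ.map f).withDensity g = (μ.withDensity fun x => g (f x)).map f := by
  ext s hs
  rw [withDensity_apply _ hs, Measure.map_apply hf hs, withDensity_apply _ (hf hs),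
    setLIntegral_map hs hg hf]

/-- Exponential tilting by `e^{-N(g)}` turns a Poisson process with intensity `ν` into one with
intensity `e^{-g} ν`, up to the normalising constant. -/
theorem poissonLaw_withDensity_expNeg (hg : Measurable g)
    (h : ∀ k, (ν.restrict (S k)).withDensity (fun z => expNeg (g z)) = ν'.restrict (S k))
    (hfin : ∫⁻ z, (1 - expNeg (g z)) ∂(Measure.sum fun k => ν.restrict (S k)) ≠ ∞) :
    (poissonLaw ν S).withDensity (fun N => expNeg (∫⁻ z, g z ∂N)) =
      expNeg (∫⁻ z, (1 - expNeg (g z)) ∂(Measure.sum fun k => ν.restrict (S k))) •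
        poissonLaw ν' S := by
  have hH : Measurable fun N : Measure E => expNeg (∫⁻ z, g z ∂N) :=
    measurable_expNeg.comp (Measure.measurable_lintegral hg)
  rw [poissonLaw, withDensity_map_comp _ measurable_measureSum hH]
  rw [lintegral_sum_measure] at hfin ⊢
  simp_rw [lintegral_sum_measure]
  rw [infinitePi_withDensity_expNeg (fun k => Measure.measurable_lintegral hg)
    (fun k => h k ▸ finitePoissonLaw_withDensity_expNeg _ hg) hfin, Measure.map_smul, poissonLaw]

end Poisson

/-! ### The extended gamma completely random measure -/

/-- The measure with density `e^{-c w}` on `(0,∞)`. It is an unnormalised exponential distribution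
of rate `c`. -/
def expDensity (c : ℝ) : Measure ℝ :=
  (volume.restrict (Set.Ioi (0 : ℝ))).withDensity fun w => ENNReal.ofReal (Real.exp (-(c * w)))

theorem measurable_expDensity_density (c : ℝ) :
    Measurable fun w : ℝ => ENNReal.ofReal (Real.exp (-(c * w))) := by fun_prop

instance expDensity.sigmaFinite (c : ℝ) : SigmaFinite (expDensity c) :=
  SigmaFinite.withDensity_ofReal _

theorem lintegral_expDensity (c : ℝ) {f : ℝ → ℝ≥0∞} (hf : Measurable f) :
    ∫⁻ w, f w ∂expDensity c =
      ∫⁻ w in Set.Ioi (0 : ℝ), ENNReal.ofReal (Real.exp (-(c * w))) * f w :=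
  lintegral_withDensity_eq_lintegral_mul _ (measurable_expDensity_density c) hf

section CRM

theorem iUnion_layer (X : Type*) : ⋃ k, layer X k = {p : X × ℝ | 0 < p.2} := by
  ext p
  simp only [layer, Set.mem_iUnion, Set.mem_prod, Set.mem_univ, true_and, Set.mem_ofPred_eq]
  constructor
  · rintro ⟨k, hk⟩
    exact lt_of_le_of_lt (by positivity) hk.1
  · intro hp
    exact exists_mem_Ioc_zpow hp one_lt_two

variable {X : Type*} [MeasurableSpace X]

theorem jumpMeasure_apply (N : Measure (X × ℝ)) {A : Set X} (hA : MeasurableSet A) :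
    jumpMeasure N A =
      ∫⁻ p, (Prod.fst ⁻¹' A).indicator (fun p : X × ℝ => ENNReal.ofReal p.2) p ∂N := by
  rw [jumpMeasure, Measure.map_apply measurable_fst hA, withDensity_apply _ (measurable_fst hA),
    lintegral_indicator (measurable_fst hA)]

theorem measurable_jump_indicator {A : Set X} (hA : MeasurableSet A) :
    Measurable ((Prod.fst ⁻¹' A).indicator fun p : X × ℝ => ENNReal.ofReal p.2) :=
  measurable_snd.ennreal_ofReal.indicator (measurable_fst hA)

theorem measurable_jumpMeasure : Measurable (jumpMeasure : Measure (X × ℝ) → Measure X) := by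
  refine Measure.measurable_of_measurable_coe _ fun A hA => ?_
  simp_rw [jumpMeasure_apply _ hA]
  exact Measure.measurable_lintegral (measurable_jump_indicator hA)

theorem jumpMeasure_add_dirac (N : Measure (X × ℝ)) (p : X × ℝ) :
    jumpMeasure (N + Measure.dirac p) =
      jumpMeasure N + ENNReal.ofReal p.2 • Measure.dirac p.1 := by
  ext A hA
  rw [jumpMeasure_apply _ hA, lintegral_add_measure, lintegral_dirac' _
    (measurable_jump_indicator hA), Measure.add_apply, jumpMeasure_apply _ hA, Measure.smul_apply,
    Measure.dirac_apply' _ hA]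
  by_cases h : p.1 ∈ A <;> simp [Set.indicator, h]

variable (a : Measure X) {b c : X → ℝ≥0}

theorem measurable_intensity_density (hc : Measurable c) : Measurable fun p : X × ℝ =>
    ENNReal.ofReal (p.2⁻¹ * Real.exp (-(p.2 * (c p.1 : ℝ)))) := by fun_prop

theorem prod_ae_pos : ∀ᵐ p ∂a.prod (volume.restrict (Set.Ioi (0 : ℝ))), 0 < p.2 := by
  rw [ae_iff]
  have : {p : X × ℝ | ¬ 0 < p.2} = Set.univ ×ˢ Set.Iic 0 := by ext p; simp
  rw [this, Measure.prod_prod, Measure.restrict_apply measurableSet_Iic]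
  have h0 : Set.Iic (0 : ℝ) ∩ Set.Ioi 0 = ∅ := by
    ext s; simp
  simp [h0]

theorem intensity_ae_pos (c : X → ℝ≥0) : ∀ᵐ p ∂intensity a c, 0 < p.2 :=
  (withDensity_absolutelyContinuous _ _).ae_le (prod_ae_pos a)

theorem measurableSet_layer (k : ℤ) : MeasurableSet (layer X k) :=
  MeasurableSet.univ.prod measurableSet_Ioc

/-- The exponent `ψ(l)`, as an extended number. -/
def laplaceExponent (a : Measure X) (b : X → ℝ≥0) (l : ℝ) : ℝ≥0∞ :=
  ∫⁻ p, (1 - expNeg (ENNReal.ofReal (l * p.2))) ∂intensity a b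

theorem laplaceExponent_toReal (b : X → ℝ≥0) {l : ℝ} (hl : 0 ≤ l) :
    (laplaceExponent a b l).toReal = psi a b l := by
  rw [laplaceExponent, psi]
  congr 1
  refine lintegral_congr_ae ?_
  filter_upwards [intensity_ae_pos a b] with p hp
  have h0 : 0 ≤ l * p.2 := mul_nonneg hl hp.le
  rw [expNeg_ofReal h0, ENNReal.ofReal_sub _ (Real.exp_pos _).le, ENNReal.ofReal_one]

theorem intensity_restrict_withDensity_expNeg (hb : Measurable b) {l : ℝ} (hl : 0 ≤ l) (k : ℤ) :
    ((intensity a b).restrict (layer X k)).withDensity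
        (fun p => expNeg (ENNReal.ofReal (l * p.2))) =
      (intensity a fun x => l.toNNReal + b x).restrict (layer X k) := by
  have hm : Measurable fun p : X × ℝ => expNeg (ENNReal.ofReal (l * p.2)) := by fun_prop
  rw [← restrict_withDensity (measurableSet_layer k)]
  congr 1
  rw [intensity, ← withDensity_mul _ (measurable_intensity_density hb) hm, intensity]
  refine withDensity_congr_ae ?_
  filter_upwards [prod_ae_pos a] with p hp
  have h0 : 0 ≤ l * p.2 := mul_nonneg hl hp.le
  simp only [Pi.mul_apply]
  rw [expNeg_ofReal h0, ← ENNReal.ofReal_mul (by positivity), mul_assoc, ← Real.exp_add]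
  congr 3
  rw [NNReal.coe_add, Real.coe_toNNReal l hl]
  ring

theorem sum_intensity_restrict_layer (c : X → ℝ≥0) :
    (Measure.sum fun k => (intensity a c).restrict (layer X k)) = intensity a c := by
  have hd : Pairwise (Function.onFun Disjoint (layer X)) := fun i j hij =>
    Set.disjoint_prod.2 (Or.inr
      ((zpow_right_mono₀ (one_le_two (α := ℝ))).pairwise_disjoint_on_Ioc_succ hij))
  rw [← Measure.restrict_iUnion hd measurableSet_layer, iUnion_layer]
  exact Measure.restrict_eq_self_of_ae_mem (intensity_ae_pos a c)

variable [IsFiniteMeasure a]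

instance crmLaw.isProbabilityMeasure (c : X → ℝ≥0) : IsProbabilityMeasure (crmLaw a c) :=
  Measure.isProbabilityMeasure_map measurable_jumpMeasure.aemeasurable

/-- The Mecke formula for the extended gamma completely random measure: size-biasing it by its
mass of `A` adds a jump at a location in `A`, and the factor `s` of the jump size cancels the `s⁻¹`
of the intensity. -/
theorem lintegral_crmLaw_mecke (hc : Measurable c) {A : Set X} (hA : MeasurableSet A)
    {G : Measure X → ℝ≥0∞} (hG : Measurable G) :
    ∫⁻ U, U A * G U ∂crmLaw a c =
      ∫⁻ x in A, ∫⁻ s, ∫⁻ U, G (U + ENNReal.ofReal s • Measure.dirac x) ∂crmLaw a c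
        ∂expDensity (c x) ∂a := by
  have hAG : Measurable fun U : Measure X => U A * G U := (Measure.measurable_coe hA).mul hG
  have hGd : ∀ (x : X) (s : ℝ), Measurable fun U : Measure X =>
      G (U + ENNReal.ofReal s • Measure.dirac x) := fun x s => hG.comp (measurable_add_const _)
  have hjoint : Measurable fun q : (X × ℝ) × Measure X =>
      G (q.2 + ENNReal.ofReal q.1.2 • Measure.dirac q.1.1) :=
    hG.comp (measurable_snd.add (measurable_smul_measure (by fun_prop)
      (Measure.measurable_dirac.comp (by fun_prop))))
  have hK : Measurable fun p : X × ℝ =>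
      ∫⁻ U, G (U + ENNReal.ofReal p.2 • Measure.dirac p.1) ∂crmLaw a c :=
    hjoint.lintegral_prod_right'
  have hind := measurable_jump_indicator hA
  have hindK : Measurable fun p : X × ℝ =>
      (Prod.fst ⁻¹' A).indicator (fun p : X × ℝ => ENNReal.ofReal p.2) p *
        ∫⁻ U, G (U + ENNReal.ofReal p.2 • Measure.dirac p.1) ∂crmLaw a c := hind.mul hK
  have hKx : ∀ x, Measurable fun s : ℝ =>
      ∫⁻ U, G (U + ENNReal.ofReal s • Measure.dirac x) ∂crmLaw a c := fun x => by
    have h := hK.comp (measurable_prodMk_left (x := x))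
    exact h
  have hGj : Measurable fun N : Measure (X × ℝ) => G (jumpMeasure N) :=
    hG.comp measurable_jumpMeasure
  calc ∫⁻ U, U A * G U ∂crmLaw a c
      = ∫⁻ N, (∫⁻ p, (Prod.fst ⁻¹' A).indicator (fun p : X × ℝ => ENNReal.ofReal p.2) p ∂N) *
          G (jumpMeasure N) ∂poissonLaw (intensity a c) (layer X) := by
        rw [crmLaw, lintegral_map hAG measurable_jumpMeasure]
        simp_rw [jumpMeasure_apply _ hA]
    _ = ∫⁻ p, (Prod.fst ⁻¹' A).indicator (fun p : X × ℝ => ENNReal.ofReal p.2) p *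
          ∫⁻ U, G (U + ENNReal.ofReal p.2 • Measure.dirac p.1) ∂crmLaw a c ∂intensity a c := by
        rw [lintegral_poissonLaw_mecke _ _ hind hGj, sum_intensity_restrict_layer]
        refine lintegral_congr fun p => ?_
        rw [crmLaw, lintegral_map (hGd p.1 p.2) measurable_jumpMeasure]
        simp_rw [jumpMeasure_add_dirac]
    _ = ∫⁻ x, A.indicator (fun x =>
          ∫⁻ s, ∫⁻ U, G (U + ENNReal.ofReal s • Measure.dirac x) ∂crmLaw a c
            ∂expDensity (c x)) x ∂a := by
        rw [intensity, lintegral_withDensity_eq_lintegral_mul _ (measurable_intensity_density hc)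
          hindK, lintegral_prod _
          ((measurable_intensity_density hc).mul hindK).aemeasurable]
        refine lintegral_congr fun x => ?_
        by_cases hx : x ∈ A
        · rw [Set.indicator_of_mem hx, lintegral_expDensity _ (hKx x)]
          refine setLIntegral_congr_fun measurableSet_Ioi fun s hs => ?_
          have hs' : (0 : ℝ) < s := hs
          have hmem : (x, s) ∈ Prod.fst ⁻¹' A := hx
          simp only [Pi.mul_apply, Set.indicator_of_mem hmem]
          rw [← mul_assoc, ← ENNReal.ofReal_mul (by positivity)]
          congr 2
          field_simp
        · have hmem : ∀ s : ℝ, (x, s) ∉ (Prod.fst : X × ℝ → X) ⁻¹' A := fun s => hx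
          simp [Set.indicator_of_notMem hx, Set.indicator_of_notMem (hmem _)]
    _ = _ := lintegral_indicator hA _

/-! ### Exponential tilting of the extended gamma completely random measure -/

theorem jumpMeasure_univ (N : Measure (X × ℝ)) :
    jumpMeasure N Set.univ = ∫⁻ p, ENNReal.ofReal p.2 ∂N := by
  simp [jumpMeasure_apply N MeasurableSet.univ]

theorem ofReal_mul_jumpMeasure_univ {l : ℝ} (hl : 0 ≤ l) (N : Measure (X × ℝ)) :
    ENNReal.ofReal l * jumpMeasure N Set.univ = ∫⁻ p, ENNReal.ofReal (l * p.2) ∂N := by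
  rw [jumpMeasure_univ, ← lintegral_const_mul _ measurable_snd.ennreal_ofReal]
  simp_rw [ENNReal.ofReal_mul hl]

theorem measurable_expNeg_mass (l : ℝ) :
    Measurable fun U : Measure X => expNeg (ENNReal.ofReal l * U Set.univ) :=
  measurable_expNeg.comp ((Measure.measurable_coe MeasurableSet.univ).const_mul _)

/-- The Laplace transform of the total mass. -/
theorem lintegral_crmLaw_expNeg (hb : Measurable b) {l : ℝ} (hl : 0 ≤ l) :
    ∫⁻ U, expNeg (ENNReal.ofReal l * U Set.univ) ∂crmLaw a b = expNeg (laplaceExponent a b l) := by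
  rw [crmLaw, lintegral_map (measurable_expNeg_mass l) measurable_jumpMeasure]
  simp_rw [ofReal_mul_jumpMeasure_univ hl]
  rw [lintegral_poissonLaw_expNeg (by fun_prop) (intensity_restrict_withDensity_expNeg a hb hl),
    sum_intensity_restrict_layer, laplaceExponent]

/-- If the total mass is finite with probability one, then `ψ(l)` is finite: its exponential
`e^{-ψ(l)}` is the expectation of a positive random variable. -/
theorem laplaceExponent_ne_top (hb : Measurable b) (hU : ∀ᵐ U ∂crmLaw a b, U Set.univ < ∞) {l : ℝ}
    (hl : 0 ≤ l) : laplaceExponent a b l ≠ ∞ := by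
  intro h
  have h0 := lintegral_crmLaw_expNeg a hb hl
  rw [h, expNeg_top, lintegral_eq_zero_iff (measurable_expNeg_mass l)] at h0
  have : ∀ᵐ _ ∂crmLaw a b, False := by
    filter_upwards [h0, hU] with U h1 h2
    exact expNeg_ne_zero (ENNReal.mul_ne_top ENNReal.ofReal_ne_top h2.ne) h1
  rw [eventually_false_iff_eq_bot, ae_eq_bot] at this
  exact IsProbabilityMeasure.ne_zero _ this

/-- Tilting the law of the completely random measure by `e^{-l U(𝔛)}` adds `l` to the rate function
and multiplies the law by `e^{-ψ(l)}`. -/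
theorem crmLaw_withDensity_expNeg (hb : Measurable b) (hU : ∀ᵐ U ∂crmLaw a b, U Set.univ < ∞)
    {l : ℝ} (hl : 0 ≤ l) :
    (crmLaw a b).withDensity (fun U => expNeg (ENNReal.ofReal l * U Set.univ)) =
      ENNReal.ofReal (Real.exp (-psi a b l)) • crmLaw a fun x => l.toNNReal + b x := by
  have hfin := laplaceExponent_ne_top a hb hU hl
  have hpsi : ENNReal.ofReal (Real.exp (-psi a b l)) = expNeg (laplaceExponent a b l) := by
    rw [← laplaceExponent_toReal a b hl, ← expNeg_ofReal ENNReal.toReal_nonneg,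
      ENNReal.ofReal_toReal hfin]
  rw [crmLaw, withDensity_map_comp _ measurable_jumpMeasure (measurable_expNeg_mass l)]
  simp_rw [ofReal_mul_jumpMeasure_univ hl]
  rw [poissonLaw_withDensity_expNeg (by fun_prop) (intensity_restrict_withDensity_expNeg a hb hl),
    sum_intensity_restrict_layer, hpsi, Measure.map_smul, crmLaw, laplaceExponent]
  rwa [sum_intensity_restrict_layer]

end CRM

/-! ### Adding jumps at the observations -/

theorem expDensity_ae_pos (c : ℝ) : ∀ᵐ w ∂expDensity c, 0 < w :=
  (withDensity_absolutelyContinuous _ _).ae_le (ae_restrict_mem measurableSet_Ioi)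

/-- Size-biasing an exponential variable adds an independent copy of it, up to normalisation. -/
theorem lintegral_expDensity_sizeBias (c : ℝ) {g : ℝ → ℝ≥0∞} (hg : Measurable g) :
    ∫⁻ w, ENNReal.ofReal w * g w ∂expDensity c =
      ∫⁻ w, ∫⁻ w', g (w + w') ∂expDensity c ∂expDensity c := by
  set k : ℝ → ℝ≥0∞ := fun t => ENNReal.ofReal (Real.exp (-(c * t))) * g t with hk
  have hkm : Measurable k := (measurable_expDensity_density c).mul hg
  have hinner : ∀ w : ℝ, ENNReal.ofReal (Real.exp (-(c * w))) *
      ∫⁻ w', g (w + w') ∂expDensity c = ∫⁻ t, (Set.Ioi w).indicator k t := by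
    intro w
    have hgw : Measurable fun w' => g (w + w') := hg.comp (measurable_const_add w)
    have hdg : Measurable fun w' => ENNReal.ofReal (Real.exp (-(c * w'))) * g (w + w') :=
      (measurable_expDensity_density c).mul hgw
    rw [lintegral_expDensity c hgw, ← lintegral_const_mul _ hdg,
      ← lintegral_indicator measurableSet_Ioi,
      ← lintegral_add_left_eq_self ((Set.Ioi w).indicator k) w]
    refine lintegral_congr fun w' => ?_
    by_cases hw : 0 < w'
    · have h1 : w' ∈ Set.Ioi (0 : ℝ) := hw
      have h2 : w + w' ∈ Set.Ioi w := by simpa using hw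
      rw [Set.indicator_of_mem h1, Set.indicator_of_mem h2, hk]
      beta_reduce
      rw [← mul_assoc, ← ENNReal.ofReal_mul (Real.exp_pos _).le, ← Real.exp_add]
      ring_nf
    · have h1 : w' ∉ Set.Ioi (0 : ℝ) := hw
      have h2 : w + w' ∉ Set.Ioi w := by simpa using hw
      rw [Set.indicator_of_notMem h1, Set.indicator_of_notMem h2]
  have hjoint : Measurable fun p : ℝ × ℝ => g (p.1 + p.2) := hg.comp measurable_add
  have hconv : Measurable fun w => ∫⁻ w', g (w + w') ∂expDensity c := hjoint.lintegral_prod_right'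
  have hS : MeasurableSet {p : ℝ × ℝ | p.1 < p.2} := measurableSet_lt measurable_fst measurable_snd
  have hsw : Measurable (Function.uncurry fun w t : ℝ => (Set.Ioi w).indicator k t) := by
    have : (Function.uncurry fun w t : ℝ => (Set.Ioi w).indicator k t) =
        {p : ℝ × ℝ | p.1 < p.2}.indicator fun p => k p.2 := by
      ext ⟨w, t⟩
      simp [Function.uncurry, Set.indicator]
    rw [this]
    exact (hkm.comp measurable_snd).indicator hS
  rw [lintegral_expDensity c (by fun_prop), lintegral_expDensity c hconv]
  simp_rw [hinner]
  -- for fixed `t = w + w'`, the values of `w` fill the interval `(0, t)`, of length `t`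
  rw [lintegral_lintegral_swap hsw.aemeasurable, ← lintegral_indicator measurableSet_Ioi]
  refine lintegral_congr fun t => ?_
  have h1 : ∀ w : ℝ, (Set.Ioi w).indicator k t = (Set.Iio t).indicator (fun _ => k t) w := by
    intro w
    simp [Set.indicator]
  simp_rw [h1]
  rw [lintegral_indicator measurableSet_Iio, setLIntegral_const, Measure.restrict_apply
    measurableSet_Iio]
  have h2 : Set.Iio t ∩ Set.Ioi 0 = Set.Ioo 0 t := by ext; simp [and_comm]
  rw [h2, Real.volume_Ioo, sub_zero]
  by_cases ht : 0 < t
  · rw [Set.indicator_of_mem (show t ∈ Set.Ioi 0 from ht), hk]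
    ring
  · rw [Set.indicator_of_notMem (show t ∉ Set.Ioi 0 from ht),
      ENNReal.ofReal_of_nonpos (not_lt.1 ht), mul_zero]

section Augmented

variable {X : Type*} [MeasurableSpace X]

/-- The configuration `U + ∑ᵢ wᵢ δ_{xᵢ}`. -/
def addJumps {n : ℕ} (x : Fin n → X) (p : Measure X × (Fin n → ℝ)) : Measure X :=
  p.1 + ∑ i, ENNReal.ofReal (p.2 i) • Measure.dirac (x i)

theorem measurable_addJumps_joint (n : ℕ) :
    Measurable fun q : (Fin n → X) × (Measure X × (Fin n → ℝ)) => addJumps q.1 q.2 :=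
  (measurable_fst.comp measurable_snd).add (measurable_finsetSum_measure _ fun i _ =>
    measurable_smul_measure (by fun_prop) (Measure.measurable_dirac.comp (by fun_prop)))

theorem measurable_addJumps {n : ℕ} (x : Fin n → X) : Measurable (addJumps x) :=
  (measurable_addJumps_joint n).comp (measurable_prodMk_left (x := x))

variable (a : Measure X) [IsFiniteMeasure a] (b : X → ℝ≥0)

/-- The image of `crmLaw a b ⊗ ⨂ᵢ e^{-b(xᵢ)w} dw` under adding jumps `wᵢ` at the points `xᵢ`.
This is the unnormalised law of the completely random measure after the observations `xᵢ`. -/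
def augmentedLaw {n : ℕ} (x : Fin n → X) : Measure (Measure X) :=
  ((crmLaw a b).prod (Measure.pi fun i => expDensity (b (x i)))).map (addJumps x)

instance augmentedLaw.sFinite {n : ℕ} (x : Fin n → X) : SFinite (augmentedLaw a b x) := by
  unfold augmentedLaw; infer_instance

theorem lintegral_augmentedLaw {n : ℕ} (x : Fin n → X) {G : Measure X → ℝ≥0∞}
    (hG : Measurable G) :
    ∫⁻ V, G V ∂augmentedLaw a b x = ∫⁻ U, ∫⁻ w, G (addJumps x (U, w))
      ∂(Measure.pi fun i => expDensity (b (x i))) ∂crmLaw a b := by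
  rw [augmentedLaw, lintegral_map hG (measurable_addJumps x)]
  exact lintegral_prod _ (hG.comp (measurable_addJumps x)).aemeasurable

theorem lintegral_augmentedLaw_zero (x : Fin 0 → X) {G : Measure X → ℝ≥0∞} (hG : Measurable G) :
    ∫⁻ V, G V ∂augmentedLaw a b x = ∫⁻ U, G U ∂crmLaw a b := by
  rw [lintegral_augmentedLaw a b x hG]
  simp [addJumps]

theorem measurable_add_jump {G : Measure X → ℝ≥0∞} (hG : Measurable G) (z : X) :
    Measurable fun p : Measure X × ℝ => G (p.1 + ENNReal.ofReal p.2 • Measure.dirac z) :=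
  hG.comp (measurable_fst.add (measurable_smul_measure (by fun_prop) measurable_const))

theorem lintegral_augmentedLaw_succ {n : ℕ} (x : Fin (n + 1) → X) {G : Measure X → ℝ≥0∞}
    (hG : Measurable G) :
    ∫⁻ V, G V ∂augmentedLaw a b x =
      ∫⁻ V, ∫⁻ w, G (V + ENNReal.ofReal w • Measure.dirac (x 0)) ∂expDensity (b (x 0))
        ∂augmentedLaw a b (fun i => x i.succ) := by
  have hG1 := measurable_add_jump hG (x 0)
  rw [lintegral_augmentedLaw a b x hG, lintegral_augmentedLaw a b _ hG1.lintegral_prod_right']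
  refine lintegral_congr fun U => ?_
  have hpair : Measurable fun q : ℝ × (Fin n → ℝ) =>
      (addJumps (fun i => x i.succ) (U, q.2), q.1) :=
    ((measurable_addJumps _).comp (measurable_const.prodMk measurable_snd)).prodMk measurable_fst
  have hf : Measurable fun q : ℝ × (Fin n → ℝ) => G (addJumps (fun i => x i.succ) (U, q.2) +
      ENNReal.ofReal q.1 • Measure.dirac (x 0)) := by
    have h := hG1.comp hpair
    exact h
  have h := lintegral_pi_fin_succ (fun i => expDensity (b (x i))) 0 hf
  simp only [Fin.succAbove_zero] at h
  rw [← lintegral_lintegral_swap hf.aemeasurable, ← h]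
  refine lintegral_congr fun w => ?_
  rw [addJumps, addJumps, Fin.sum_univ_succ, add_right_comm, add_assoc]

theorem lintegral_augmentedLaw_cons {n : ℕ} (y : X) (x : Fin n → X) {G : Measure X → ℝ≥0∞}
    (hG : Measurable G) :
    ∫⁻ V, G V ∂augmentedLaw a b (Fin.cons y x : Fin (n + 1) → X) =
      ∫⁻ V, ∫⁻ w, G (V + ENNReal.ofReal w • Measure.dirac y) ∂expDensity (b y)
        ∂augmentedLaw a b x := by
  rw [lintegral_augmentedLaw_succ a b _ hG]
  simp

variable {b}

theorem measurable_lintegral_augmentedLaw (hb : Measurable b) {n : ℕ}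
    {H : (Fin n → X) × Measure X → ℝ≥0∞} (hH : Measurable H) :
    Measurable fun x : Fin n → X => ∫⁻ V, H (x, V) ∂augmentedLaw a b x := by
  set L : Measure (Fin n → ℝ) := Measure.pi fun _ => volume.restrict (Set.Ioi (0 : ℝ)) with hL
  have hd : Measurable fun q : (Fin n → X) × (Measure X × (Fin n → ℝ)) =>
      ∏ i, ENNReal.ofReal (Real.exp (-(b (q.1 i) * q.2.2 i))) := by fun_prop
  have hHj : Measurable fun q : (Fin n → X) × (Measure X × (Fin n → ℝ)) =>
      H (q.1, addJumps q.1 q.2) :=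
    hH.comp (measurable_fst.prodMk (measurable_addJumps_joint n))
  have key : ∀ x : Fin n → X, ∫⁻ V, H (x, V) ∂augmentedLaw a b x =
      ∫⁻ p, (∏ i, ENNReal.ofReal (Real.exp (-(b (x i) * p.2 i)))) * H (x, addJumps x p)
        ∂(crmLaw a b).prod L := by
    intro x
    have hHx : Measurable fun V => H (x, V) := hH.comp measurable_prodMk_left
    have hdx : Measurable fun w : Fin n → ℝ =>
      ∏ i, ENNReal.ofReal (Real.exp (-(b (x i) * w i))) := by fun_prop
    rw [lintegral_augmentedLaw a b x hHx]
    have hpi : (Measure.pi fun i => expDensity (b (x i))) = L.withDensity fun w =>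
        ∏ i, ENNReal.ofReal (Real.exp (-(b (x i) * w i))) := by
      have : ∀ i : Fin n, SigmaFinite ((volume.restrict (Set.Ioi (0 : ℝ))).withDensity
          fun w => ENNReal.ofReal (Real.exp (-(b (x i) * w)))) := fun i =>
        SigmaFinite.withDensity_ofReal _
      exact pi_withDensity (fun _ : Fin n => volume.restrict (Set.Ioi (0 : ℝ)))
        (f := fun i w => ENNReal.ofReal (Real.exp (-(b (x i) * w)))) fun i => by fun_prop
    have hx : Measurable fun p : Measure X × (Fin n → ℝ) => H (x, addJumps x p) :=
      hHx.comp (measurable_addJumps x)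
    have hprod : Measurable fun p : Measure X × (Fin n → ℝ) =>
        (∏ i, ENNReal.ofReal (Real.exp (-(b (x i) * p.2 i)))) * H (x, addJumps x p) :=
      (hdx.comp measurable_snd).mul hx
    rw [lintegral_prod _ hprod.aemeasurable, hpi]
    refine lintegral_congr fun U => ?_
    have hU : Measurable fun w : Fin n → ℝ => H (x, addJumps x (U, w)) := by
      have h := hx.comp (measurable_prodMk_left (x := U))
      exact h
    rw [lintegral_withDensity_eq_lintegral_mul _ hdx hU]
    rfl
  simp_rw [key]
  exact (hd.mul hHj).lintegral_prod_right'

/-- The Mecke formula for the completely random measure with jumps added at the observations: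
size-biasing by the mass of `A` adds one more observation, at a new location in `A` or at one of
the previous locations in `A`. -/
theorem lintegral_augmentedLaw_mecke (hb : Measurable b) {A : Set X} (hA : MeasurableSet A)
    {n : ℕ} (x : Fin n → X) {G : Measure X → ℝ≥0∞} (hG : Measurable G) :
    ∫⁻ V, V A * G V ∂augmentedLaw a b x =
      ∫⁻ y in A, ∫⁻ V, G V ∂augmentedLaw a b (Fin.cons y x : Fin (n + 1) → X) ∂a +
        ∑ i, A.indicator (fun y =>
          ∫⁻ V, G V ∂augmentedLaw a b (Fin.cons y x : Fin (n + 1) → X)) (x i) := by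
  have hAm : Measurable fun V : Measure X => V A := Measure.measurable_coe hA
  induction n generalizing G with
  | zero =>
    have hAG : Measurable fun V : Measure X => V A * G V := hAm.mul hG
    rw [lintegral_augmentedLaw_zero a b x hAG, lintegral_crmLaw_mecke a hb hA hG]
    simp only [Finset.univ_eq_empty, Finset.sum_empty, add_zero]
    refine lintegral_congr fun y => ?_
    have h1 := measurable_add_jump hG y
    rw [lintegral_augmentedLaw_cons a b y x hG,
      lintegral_augmentedLaw_zero a b x h1.lintegral_prod_right']
    exact (lintegral_lintegral_swap h1.aemeasurable).symm
  | succ n ih =>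
    set x' : Fin n → X := fun i => x i.succ with hx'
    set z := x 0 with hz
    set H : Measure X → ℝ≥0∞ := fun V =>
      ∫⁻ w, G (V + ENNReal.ofReal w • Measure.dirac z) ∂expDensity (b z) with hH
    have hGz := measurable_add_jump hG z
    have hHm : Measurable H := hGz.lintegral_prod_right'
    -- adding a jump at `z` and a jump at `y` in either order gives the same result
    have hswap : ∀ y, ∫⁻ V, H V ∂augmentedLaw a b (Fin.cons y x' : Fin (n + 1) → X) =
        ∫⁻ V, G V ∂augmentedLaw a b (Fin.cons y x : Fin (n + 2) → X) := by
      intro y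
      have hGy := measurable_add_jump hG y
      rw [lintegral_augmentedLaw_cons a b y x' hHm, lintegral_augmentedLaw_cons a b y x hG,
        lintegral_augmentedLaw_succ a b x hGy.lintegral_prod_right']
      refine lintegral_congr fun V => ?_
      have hVm : Measurable fun p : ℝ × ℝ => G (V + ENNReal.ofReal p.1 • Measure.dirac y +
          ENNReal.ofReal p.2 • Measure.dirac z) :=
        hG.comp (((measurable_smul_measure (by fun_prop) measurable_const).const_add V).add
          (measurable_smul_measure (by fun_prop) measurable_const))
      simp only [hH]
      rw [lintegral_lintegral_swap hVm.aemeasurable]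
      simp_rw [add_right_comm V (_ • Measure.dirac y)]
      rfl
    have hAG : Measurable fun V : Measure X => V A * G V := hAm.mul hG
    have hsplit : ∀ V : Measure X, ∫⁻ w, (V + ENNReal.ofReal w • Measure.dirac z) A *
        G (V + ENNReal.ofReal w • Measure.dirac z) ∂expDensity (b z) = V A * H V +
        A.indicator 1 z * ∫⁻ w, H (V + ENNReal.ofReal w • Measure.dirac z) ∂expDensity (b z) := by
      intro V
      have hVm : Measurable fun w : ℝ => G (V + ENNReal.ofReal w • Measure.dirac z) := by
        have h := hGz.comp (measurable_prodMk_left (x := V))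
        exact h
      have hbias := lintegral_expDensity_sizeBias (b z) hVm
      have hconv : ∫⁻ w, ∫⁻ w', G (V + ENNReal.ofReal (w + w') • Measure.dirac z)
          ∂expDensity (b z) ∂expDensity (b z) =
          ∫⁻ w, H (V + ENNReal.ofReal w • Measure.dirac z) ∂expDensity (b z) := by
        refine lintegral_congr_ae ?_
        filter_upwards [expDensity_ae_pos (b z)] with w hw
        refine lintegral_congr_ae ?_
        filter_upwards [expDensity_ae_pos (b z)] with w' hw'
        rw [ENNReal.ofReal_add hw.le hw'.le, add_smul, add_assoc]
      rw [hconv] at hbias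
      have hwV : Measurable fun w : ℝ =>
        ENNReal.ofReal w * G (V + ENNReal.ofReal w • Measure.dirac z) := by fun_prop
      rw [← hbias, hH, ← lintegral_const_mul _ hVm, ← lintegral_const_mul _ hwV,
        ← lintegral_add_left (hVm.const_mul _)]
      refine lintegral_congr fun w => ?_
      rw [Measure.add_apply, Measure.smul_apply, Measure.dirac_apply' _ hA, smul_eq_mul]
      ring
    rw [lintegral_augmentedLaw_succ a b x hAG]
    simp_rw [← hz, hsplit]
    have hHz := measurable_add_jump hHm z
    have hHz' : Measurable fun V : Measure X =>
      ∫⁻ w, H (V + ENNReal.ofReal w • Measure.dirac z) ∂expDensity (b z) :=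
      hHz.lintegral_prod_right'
    have hAH : Measurable fun V : Measure X => V A * H V := hAm.mul hHm
    rw [lintegral_add_left hAH, lintegral_const_mul _ hHz', ih x' hHm,
      ← lintegral_augmentedLaw_cons a b z x' hHm, hswap]
    simp_rw [hswap]
    rw [Fin.sum_univ_succ, add_assoc, add_comm (∑ i, _)]
    congr 2
    by_cases hzA : z ∈ A <;> simp [Set.indicator, ← hz, hzA]

end Augmented

/-! ### Moments of the completely random measure -/

section Urn

variable {X : Type*} [MeasurableSpace X] (a : Measure X)

/-- The unnormalised law of `n` draws from the Pólya urn with initial measure `a`: given the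
previous draws `x`, the next draw has the unnormalised law `a + ∑ᵢ δ_{xᵢ}`. The newest draw is put
in coordinate `0`. -/
def urnMeasure : (n : ℕ) → Measure (Fin n → X)
  | 0 => Measure.dirac Fin.elim0
  | n + 1 => (urnMeasure n).bind fun x =>
      (a + ∑ i, Measure.dirac (x i)).map fun y => (Fin.cons y x : Fin (n + 1) → X)

theorem measurable_fin_cons {n : ℕ} :
    Measurable fun p : (Fin n → X) × X => (Fin.cons p.2 p.1 : Fin (n + 1) → X) := by
  refine measurable_pi_lambda _ fun i => ?_
  refine Fin.cases ?_ (fun j => ?_) i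
  · exact measurable_snd
  · simp only [Fin.cons_succ]
    fun_prop

theorem measurable_fin_cons_left {n : ℕ} (x : Fin n → X) :
    Measurable fun y : X => (Fin.cons y x : Fin (n + 1) → X) :=
  measurable_fin_cons.comp (measurable_prodMk_left (x := x))

theorem lintegral_urn_step {n : ℕ} (x : Fin n → X) {f : (Fin (n + 1) → X) → ℝ≥0∞}
    (hf : Measurable f) :
    ∫⁻ z, f z ∂(a + ∑ i, Measure.dirac (x i)).map (fun y => (Fin.cons y x : Fin (n + 1) → X)) =
      ∫⁻ y, f (Fin.cons y x) ∂a + ∑ i, f (Fin.cons (x i) x) := by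
  have hfx : Measurable fun y : X => f (Fin.cons y x) := hf.comp (measurable_fin_cons_left x)
  rw [lintegral_map hf (measurable_fin_cons_left x), lintegral_add_measure,
    lintegral_finsetSum_measure]
  simp_rw [lintegral_dirac' _ hfx]

variable [IsFiniteMeasure a]

theorem measurable_lintegral_urn_step {n : ℕ} {f : (Fin (n + 1) → X) → ℝ≥0∞}
    (hf : Measurable f) :
    Measurable fun x : Fin n → X => ∫⁻ y, f (Fin.cons y x) ∂a + ∑ i, f (Fin.cons (x i) x) := by
  have h : Measurable fun p : (Fin n → X) × X => f (Fin.cons p.2 p.1) := hf.comp measurable_fin_cons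
  refine h.lintegral_prod_right'.add (Finset.measurable_sum _ fun i _ => ?_)
  have hi : Measurable fun x : Fin n → X => (x, x i) := by fun_prop
  exact h.comp hi

theorem lintegral_urnMeasure_succ {n : ℕ} {f : (Fin (n + 1) → X) → ℝ≥0∞} (hf : Measurable f) :
    ∫⁻ z, f z ∂urnMeasure a (n + 1) =
      ∫⁻ x, (∫⁻ y, f (Fin.cons y x) ∂a + ∑ i, f (Fin.cons (x i) x)) ∂urnMeasure a n := by
  have hk : Measurable fun x : Fin n → X =>
      (a + ∑ i, Measure.dirac (x i)).map fun y => (Fin.cons y x : Fin (n + 1) → X) := by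
    refine Measure.measurable_of_measurable_coe _ fun s hs => ?_
    simp_rw [← lintegral_indicator_one hs,
      fun x : Fin n → X => lintegral_urn_step a x (measurable_one.indicator hs)]
    exact measurable_lintegral_urn_step a (measurable_one.indicator hs)
  rw [urnMeasure, Measure.lintegral_bind hk.aemeasurable hf.aemeasurable]
  simp_rw [lintegral_urn_step a _ hf]

variable {b : X → ℝ≥0}

/-- The iterated Mecke formula: size-biasing by the masses of `B₀, …, B_{n-1}` amounts to adding `n`
observations drawn from the urn. -/
theorem lintegral_crmLaw_prod (hb : Measurable b) {n : ℕ} {B : Fin n → Set X}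
    (hB : ∀ i, MeasurableSet (B i)) {G : Measure X → ℝ≥0∞} (hG : Measurable G) :
    ∫⁻ U, (∏ i, U (B i)) * G U ∂crmLaw a b =
      ∫⁻ x in Set.univ.pi B, ∫⁻ V, G V ∂augmentedLaw a b x ∂urnMeasure a n := by
  induction n generalizing G with
  | zero =>
    have hbox : Set.univ.pi B = Set.univ := by ext; simp
    have hK : Measurable fun x : Fin 0 → X => ∫⁻ V, G V ∂augmentedLaw a b x :=
      measurable_lintegral_augmentedLaw a hb (H := fun q => G q.2) (hG.comp measurable_snd)
    rw [urnMeasure, hbox, Measure.restrict_univ, lintegral_dirac' _ hK]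
    simp [lintegral_augmentedLaw_zero a b _ hG]
  | succ n ih =>
    have hB0 : Measurable fun U : Measure X => U (B 0) * G U :=
      (Measure.measurable_coe (hB 0)).mul hG
    have hK : Measurable fun x : Fin (n + 1) → X => ∫⁻ V, G V ∂augmentedLaw a b x :=
      measurable_lintegral_augmentedLaw a hb (H := fun q => G q.2) (hG.comp measurable_snd)
    have hbox : MeasurableSet (Set.univ.pi B) := MeasurableSet.univ_pi hB
    have hbox' : MeasurableSet (Set.univ.pi fun i : Fin n => B i.succ) :=
      MeasurableSet.univ_pi fun i => hB i.succ
    have hfac : ∀ U : Measure X, (∏ i, U (B i)) * G U =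
        (∏ i : Fin n, U (B i.succ)) * (U (B 0) * G U) := fun U => by
      rw [Fin.prod_univ_succ]; ring
    simp_rw [hfac]
    rw [ih (fun i => hB i.succ) hB0, ← lintegral_indicator hbox,
      lintegral_urnMeasure_succ a (hK.indicator hbox), ← lintegral_indicator hbox']
    refine lintegral_congr fun x => ?_
    have hmem : ∀ y, (Fin.cons y x : Fin (n + 1) → X) ∈ Set.univ.pi B ↔
        y ∈ B 0 ∧ x ∈ Set.univ.pi fun i : Fin n => B i.succ := by
      intro y
      simp [Set.mem_pi, Fin.forall_fin_succ]
    by_cases hx : x ∈ Set.univ.pi fun i : Fin n => B i.succ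
    · rw [Set.indicator_of_mem hx, lintegral_augmentedLaw_mecke a hb (hB 0) x hG,
        ← lintegral_indicator (hB 0)]
      have hind : ∀ y, (Set.univ.pi B).indicator
          (fun x : Fin (n + 1) → X => ∫⁻ V, G V ∂augmentedLaw a b x) (Fin.cons y x) =
          (B 0).indicator (fun y => ∫⁻ V, G V
            ∂augmentedLaw a b (Fin.cons y x : Fin (n + 1) → X)) y := by
        intro y
        by_cases hy : y ∈ B 0
        · rw [Set.indicator_of_mem ((hmem y).2 ⟨hy, hx⟩), Set.indicator_of_mem hy]
        · rw [Set.indicator_of_notMem fun h => hy ((hmem y).1 h).1, Set.indicator_of_notMem hy]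
      simp_rw [hind]
    · have hind : ∀ y, (Set.univ.pi B).indicator
          (fun x : Fin (n + 1) → X => ∫⁻ V, G V ∂augmentedLaw a b x) (Fin.cons y x) = 0 :=
        fun y => Set.indicator_of_notMem (fun h => hx ((hmem y).1 h).2) _
      simp [hind, Set.indicator_of_notMem hx]

end Urn

/-! ### Exponential tilting with added jumps -/

theorem expDensity_withDensity_expNeg {l : ℝ} (hl : 0 ≤ l) (c : ℝ) :
    (expDensity c).withDensity (fun w => expNeg (ENNReal.ofReal l * ENNReal.ofReal w)) =
      expDensity (l + c) := by
  have hm : Measurable fun w : ℝ => expNeg (ENNReal.ofReal l * ENNReal.ofReal w) := by fun_prop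
  rw [expDensity, ← withDensity_mul _ (measurable_expDensity_density c) hm, expDensity]
  refine withDensity_congr_ae ?_
  filter_upwards [ae_restrict_mem measurableSet_Ioi] with w hw
  have hw' : (0 : ℝ) < w := hw
  simp only [Pi.mul_apply]
  rw [← ENNReal.ofReal_mul hl, expNeg_ofReal (by positivity),
    ← ENNReal.ofReal_mul (Real.exp_pos _).le, ← Real.exp_add]
  ring_nf

theorem expMeasure_eq_smul {r : ℝ} (hr : 0 < r) :
    expMeasure r = ENNReal.ofReal r • expDensity r := by
  have h : expMeasure r = volume.withDensity (exponentialPDF r) := rfl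
  rw [h, expDensity, ← withDensity_smul _ (measurable_expDensity_density r),
    ← withDensity_indicator measurableSet_Ioi]
  refine withDensity_congr_ae ?_
  filter_upwards [Measure.ae_ne volume (0 : ℝ)] with w hw
  rw [exponentialPDF_eq]
  rcases lt_or_gt_of_ne hw with h0 | h0
  · rw [if_neg (not_le.2 h0), Set.indicator_of_notMem (by simpa using h0.le)]
    simp
  · rw [if_pos h0.le, Set.indicator_of_mem (by simpa using h0), Pi.smul_apply, smul_eq_mul,
      ENNReal.ofReal_mul hr.le]

section Tilt

variable {X : Type*} [MeasurableSpace X] (a : Measure X) [IsFiniteMeasure a] {b : X → ℝ≥0}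

theorem addJumps_univ {n : ℕ} (x : Fin n → X) (p : Measure X × (Fin n → ℝ)) :
    addJumps x p Set.univ = p.1 Set.univ + ∑ i, ENNReal.ofReal (p.2 i) := by
  simp [addJumps]

/-- Tilting by `e^{-l V(𝔛)}` adds `l` to the rates of the completely random measure and of the
exponential jumps. The factor `∏ᵢ (l + b(xᵢ))⁻¹` normalises the densities of the jumps. -/
theorem prod_crmLaw_expMeasure_eq_withDensity (hb : Measurable b)
    (hU : ∀ᵐ U ∂crmLaw a b, U Set.univ < ∞) {l : ℝ} (hl : 0 < l) {n : ℕ} (x : Fin n → X) :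
    ENNReal.ofReal (Real.exp (-psi a b l) * ∏ i, (l + (b (x i) : ℝ))⁻¹) •
        ((crmLaw a fun y => l.toNNReal + b y).prod
          (Measure.pi fun i => expMeasure (l + (b (x i) : ℝ)))) =
      ((crmLaw a b).prod (Measure.pi fun i => expDensity (b (x i)))).withDensity
        fun p => expNeg (ENNReal.ofReal l * addJumps x p Set.univ) := by
  have hr : ∀ i, 0 < l + (b (x i) : ℝ) := fun i => by positivity
  have hm : Measurable fun w : ℝ => expNeg (ENNReal.ofReal l * ENNReal.ofReal w) := by fun_prop
  have hpi1 : (Measure.pi fun i => expDensity (l + (b (x i) : ℝ))) =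
      (Measure.pi fun i => expDensity (b (x i))).withDensity fun w =>
        ∏ i, expNeg (ENNReal.ofReal l * ENNReal.ofReal (w i)) := by
    have : ∀ i : Fin n, SigmaFinite ((expDensity (b (x i))).withDensity fun w =>
        expNeg (ENNReal.ofReal l * ENNReal.ofReal w)) := fun i => by
      rw [expDensity_withDensity_expNeg hl.le]; infer_instance
    rw [← pi_withDensity (fun i => expDensity (b (x i)))
      (f := fun _ w => expNeg (ENNReal.ofReal l * ENNReal.ofReal w)) fun _ => hm]
    simp_rw [expDensity_withDensity_expNeg hl.le]
  have hpi2 : (Measure.pi fun i => expMeasure (l + (b (x i) : ℝ))) =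
      (∏ i, ENNReal.ofReal (l + (b (x i) : ℝ))) •
        Measure.pi fun i => expDensity (l + (b (x i) : ℝ)) := by
    have : ∀ i : Fin n, SigmaFinite (ENNReal.ofReal (l + (b (x i) : ℝ)) •
        expDensity (l + (b (x i) : ℝ))) := fun i => by
      rw [← expMeasure_eq_smul (hr i)]
      have := isProbabilityMeasure_expMeasure (hr i)
      infer_instance
    rw [← pi_smul]
    simp_rw [expMeasure_eq_smul (hr _)]
  have hcancel : (∏ i, ENNReal.ofReal (l + (b (x i) : ℝ))⁻¹) *
      ∏ i, ENNReal.ofReal (l + (b (x i) : ℝ)) = 1 := by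
    rw [← Finset.prod_mul_distrib]
    refine Finset.prod_eq_one fun i _ => ?_
    rw [← ENNReal.ofReal_mul (inv_nonneg.2 (hr i).le), inv_mul_cancel₀ (hr i).ne',
      ENNReal.ofReal_one]
  have hprod : Measurable fun w : Fin n → ℝ =>
      ∏ i, expNeg (ENNReal.ofReal l * ENNReal.ofReal (w i)) := by fun_prop
  rw [ENNReal.ofReal_mul (Real.exp_pos _).le,
    ENNReal.ofReal_prod_of_nonneg fun i _ => inv_nonneg.2 (hr i).le, hpi2,
    Measure.prod_smul_right, smul_smul, mul_assoc, hcancel, mul_one, ← Measure.prod_smul_left,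
    ← crmLaw_withDensity_expNeg a hb hU hl.le, hpi1,
    prod_withDensity (measurable_expNeg_mass l) hprod]
  refine congrArg _ (funext fun p => ?_)
  rw [addJumps_univ, mul_add, expNeg_add, Finset.mul_sum, expNeg_sum]

end Tilt

/-! ### The posterior as a normalised weighted law -/

/-- The Gamma integral `∫_0^∞ l^{n-1} e^{-l v} dl = (n-1)! v^{-n}`. -/
theorem lintegral_pow_mul_expNeg {n : ℕ} (hn : 1 ≤ n) {v : ℝ≥0∞} (hv0 : v ≠ 0) (hv : v ≠ ∞) :
    ∫⁻ l in Set.Ioi (0 : ℝ), ENNReal.ofReal (l ^ (n - 1)) * expNeg (ENNReal.ofReal l * v) =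
      (((n - 1)! : ℕ) : ℝ≥0∞) * v⁻¹ ^ n := by
  obtain ⟨r, hr, rfl⟩ : ∃ r : ℝ, 0 < r ∧ v = ENNReal.ofReal r :=
    ⟨v.toReal, ENNReal.toReal_pos hv0 hv, (ENNReal.ofReal_toReal hv).symm⟩
  have hn0 : (0 : ℝ) < n := by exact_mod_cast hn
  have hint := Real.integral_rpow_mul_exp_neg_mul_Ioi hn0 hr
  have hG : Real.Gamma n = ((n - 1)! : ℕ) := by
    have h := Real.Gamma_nat_eq_factorial (n - 1)
    rwa [← Nat.cast_add_one, Nat.sub_add_cancel hn] at h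
  have hpos : 0 < (1 / r) ^ (n : ℝ) * Real.Gamma n :=
    mul_pos (by positivity) (Real.Gamma_pos_of_pos hn0)
  have hintegrable : IntegrableOn (fun t : ℝ => t ^ ((n : ℝ) - 1) * Real.exp (-(r * t)))
      (Set.Ioi 0) := by
    by_contra h
    rw [integral_undef h] at hint
    exact hpos.ne hint
  have h1 : ∫⁻ l in Set.Ioi (0 : ℝ), ENNReal.ofReal (l ^ (n - 1)) *
      expNeg (ENNReal.ofReal l * ENNReal.ofReal r) =
      ∫⁻ l in Set.Ioi (0 : ℝ), ENNReal.ofReal (l ^ ((n : ℝ) - 1) * Real.exp (-(r * l))) := by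
    refine setLIntegral_congr_fun measurableSet_Ioi fun l hl => ?_
    have hl0 : (0 : ℝ) < l := hl
    have hcast : (n : ℝ) - 1 = ((n - 1 : ℕ) : ℝ) := by rw [Nat.cast_sub hn, Nat.cast_one]
    rw [← ENNReal.ofReal_mul hl0.le, expNeg_ofReal (by positivity),
      ← ENNReal.ofReal_mul (by positivity), hcast, Real.rpow_natCast, mul_comm l r]
  rw [h1, ← ofReal_integral_eq_lintegral_ofReal hintegrable, hint, hG, Real.rpow_natCast,
    one_div, ENNReal.ofReal_mul (by positivity), ENNReal.ofReal_pow (by positivity),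
    ENNReal.ofReal_inv_of_pos hr, ENNReal.ofReal_natCast, mul_comm]
  filter_upwards [ae_restrict_mem measurableSet_Ioi] with l hl
  have hl0 : (0 : ℝ) < l := hl
  simp only [Pi.zero_apply]
  positivity

section Posterior

variable {X : Type*} [MeasurableSpace X] (a : Measure X) (b : X → ℝ≥0)

/-- The density of the mixing distribution, up to normalisation. -/
def mixingDensity {n : ℕ} (x : Fin n → X) (l : ℝ) : ℝ :=
  l ^ (n - 1) * Real.exp (-psi a b l) * ∏ i, (l + (b (x i) : ℝ))⁻¹

theorem mixingWeight_eq {n : ℕ} (x : Fin n → X) : mixingWeight a b x =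
    (volume.restrict (Set.Ioi (0 : ℝ))).withDensity
      fun l => ENNReal.ofReal (mixingDensity a b x l) := rfl

theorem mixingDensity_pos {b : X → ℝ≥0} (hb_pos : ∀ x, 0 < b x) {n : ℕ} (x : Fin n → X)
    {l : ℝ} (hl : 0 < l) : 0 < mixingDensity a b x l := by
  have : ∀ i, (0 : ℝ) < b (x i) := fun i => hb_pos (x i)
  unfold mixingDensity
  have h2 : 0 < ∏ i, (l + (b (x i) : ℝ))⁻¹ := Finset.prod_pos fun i _ => by positivity
  positivity

/-- Up to a constant, the mixing density for any number of observations is bounded by the one for a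
single observation at any given point. -/
theorem mixingDensity_le {b : X → ℝ≥0} (hb_pos : ∀ x, 0 < b x) {n : ℕ} (hn : 1 ≤ n) (x : Fin n → X)
    (y : Fin 1 → X) : ∃ K : ℝ, 0 ≤ K ∧ ∀ l, 0 < l →
      mixingDensity a b x l ≤ K * mixingDensity a b y l := by
  obtain ⟨n, rfl⟩ := Nat.exists_eq_add_of_le' hn
  have hx : ∀ i, (0 : ℝ) < b (x i) := fun i => hb_pos (x i)
  have hy : (0 : ℝ) < b (y 0) := hb_pos (y 0)
  have hx0 := hx 0
  -- `(l + b y) / (l + b x₀) ≤ 1 + b y / b x₀`; each further factor `l / (l + b xᵢ)` is at most `1`.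
  refine ⟨1 + b (y 0) / b (x 0), by positivity, fun l hl => ?_⟩
  have h1 : l ^ n * ∏ i : Fin n, (l + (b (x i.succ) : ℝ))⁻¹ ≤ 1 := by
    have : l ^ n = ∏ _i : Fin n, l := by simp
    rw [this, ← Finset.prod_mul_distrib]
    refine Finset.prod_le_one (fun i _ => ?_) fun i _ => ?_
    · have := hx i.succ; positivity
    · have := hx i.succ
      rw [← div_eq_mul_inv, div_le_one (by positivity)]
      linarith
  have h2 : (l + (b (x 0) : ℝ))⁻¹ ≤ (1 + b (y 0) / b (x 0)) * (l + (b (y 0) : ℝ))⁻¹ := by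
    rw [← div_eq_mul_inv, le_div_iff₀ (by positivity), inv_mul_le_iff₀ (by positivity)]
    have h3 : (b (x 0) : ℝ) * (b (y 0) / b (x 0)) = b (y 0) := by field_simp
    have h4 : 0 ≤ l * ((b (y 0) : ℝ) / b (x 0)) := by positivity
    nlinarith
  have h0 : (0 : ℝ) ≤ (l + (b (x 0) : ℝ))⁻¹ := by positivity
  unfold mixingDensity
  rw [Fin.prod_univ_succ]
  simp only [Nat.add_sub_cancel, Nat.sub_self, pow_zero, one_mul, Finset.univ_unique,
    Fin.default_eq_zero, Finset.prod_singleton]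
  calc l ^ n * Real.exp (-psi a b l) *
        ((l + (b (x 0) : ℝ))⁻¹ * ∏ i : Fin n, (l + (b (x i.succ) : ℝ))⁻¹)
      = Real.exp (-psi a b l) * ((l + (b (x 0) : ℝ))⁻¹ *
          (l ^ n * ∏ i : Fin n, (l + (b (x i.succ) : ℝ))⁻¹)) := by ring
    _ ≤ Real.exp (-psi a b l) * ((1 + b (y 0) / b (x 0)) * (l + (b (y 0) : ℝ))⁻¹) := by
        refine mul_le_mul_of_nonneg_left ?_ (Real.exp_pos _).le
        exact (mul_le_of_le_one_right h0 h1).trans h2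
    _ = _ := by ring

/-- A new observation multiplies the mixing density by `l / (l + b(y)) ≤ 1`. -/
theorem mixingDensity_cons_le {b : X → ℝ≥0} (hb_pos : ∀ x, 0 < b x) {n : ℕ} (hn : 1 ≤ n)
    (x : Fin n → X) (y : X) {l : ℝ} (hl : 0 < l) :
    mixingDensity a b (Fin.cons y x : Fin (n + 1) → X) l ≤ mixingDensity a b x l := by
  have hy : (0 : ℝ) < b y := hb_pos y
  have hpos := mixingDensity_pos a hb_pos x hl
  have hpow : l ^ n = l ^ (n - 1) * l := by rw [← pow_succ, Nat.sub_add_cancel hn]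
  have h : mixingDensity a b (Fin.cons y x : Fin (n + 1) → X) l =
      mixingDensity a b x l * (l * (l + (b y : ℝ))⁻¹) := by
    unfold mixingDensity
    rw [Fin.prod_univ_succ]
    simp only [Fin.cons_zero, Fin.cons_succ, Nat.add_sub_cancel, hpow]
    ring
  rw [h]
  refine mul_le_of_le_one_right hpos.le ?_
  rw [← div_eq_mul_inv, div_le_one (by positivity)]
  linarith

variable [IsFiniteMeasure a]

/-- The unnormalised posterior: the image under normalisation of the law of `V = U + ∑ᵢ wᵢ δ_{xᵢ}`
weighted by `V(𝔛)^{-n}`. -/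
def posteriorWeight {n : ℕ} (x : Fin n → X) : Measure (Measure X) :=
  ((augmentedLaw a b x).withDensity fun V => (V Set.univ)⁻¹ ^ n).map normalise

theorem measurable_inv_mass_pow (n : ℕ) :
    Measurable fun V : Measure X => (V Set.univ)⁻¹ ^ n :=
  (Measure.measurable_coe MeasurableSet.univ).inv.pow_const n

theorem lintegral_posteriorWeight {n : ℕ} (x : Fin n → X) {F : Measure X → ℝ≥0∞}
    (hF : Measurable F) :
    ∫⁻ P, F P ∂posteriorWeight a b x =
      ∫⁻ V, (V Set.univ)⁻¹ ^ n * F (normalise V) ∂augmentedLaw a b x := by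
  rw [posteriorWeight, lintegral_map hF measurable_normalise]
  exact lintegral_withDensity_eq_lintegral_mul _ (measurable_inv_mass_pow n)
    (hF.comp measurable_normalise)

theorem posteriorWeight_univ {n : ℕ} (x : Fin n → X) :
    posteriorWeight a b x Set.univ = ∫⁻ V, (V Set.univ)⁻¹ ^ n ∂augmentedLaw a b x := by
  rw [← lintegral_one, lintegral_posteriorWeight a b x measurable_const]
  simp

theorem posteriorWeight_apply {n : ℕ} (x : Fin n → X) {C : Set (Measure X)}
    (hC : MeasurableSet C) :
    posteriorWeight a b x C = ∫⁻ V, (V Set.univ)⁻¹ ^ n * C.indicator 1 (normalise V)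
      ∂augmentedLaw a b x := by
  rw [← lintegral_indicator_one hC, lintegral_posteriorWeight a b x (measurable_one.indicator hC)]

theorem augmentedLaw_ae_mass (hU : ∀ᵐ U ∂crmLaw a b, 0 < U Set.univ ∧ U Set.univ < ∞) {n : ℕ}
    (x : Fin n → X) : ∀ᵐ V ∂augmentedLaw a b x, V Set.univ ≠ 0 ∧ V Set.univ ≠ ∞ := by
  have hms : MeasurableSet {V : Measure X | V Set.univ ≠ 0 ∧ V Set.univ ≠ ∞} := by
    have h1 : Measurable fun V : Measure X => V Set.univ :=
      Measure.measurable_coe MeasurableSet.univ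
    exact (h1 (measurableSet_singleton 0).compl).inter (h1 (measurableSet_singleton ∞).compl)
  rw [augmentedLaw, ae_map_iff (measurable_addJumps x).aemeasurable hms]
  filter_upwards [Measure.quasiMeasurePreserving_fst.ae hU] with p hp
  rw [addJumps_univ]
  refine ⟨?_, ?_⟩
  · exact (lt_of_lt_of_le hp.1 le_self_add).ne'
  · exact ENNReal.add_ne_top.2 ⟨hp.2.ne, ENNReal.sum_ne_top.2 fun i _ => ENNReal.ofReal_ne_top⟩

theorem expDensity_ne_zero (c : ℝ) : expDensity c ≠ 0 := by
  rw [expDensity, Ne, withDensity_eq_zero_iff (measurable_expDensity_density c).aemeasurable]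
  intro h
  have h2 : ∀ᵐ _ ∂(volume.restrict (Set.Ioi (0 : ℝ))), False := by
    filter_upwards [h] with w hw
    have := Real.exp_pos (-(c * w))
    simp only [Pi.zero_apply, ENNReal.ofReal_eq_zero] at hw
    linarith
  rw [eventually_false_iff_eq_bot, ae_eq_bot, Measure.restrict_eq_zero] at h2
  simp at h2

theorem augmentedLaw_ne_zero {n : ℕ} (x : Fin n → X) : augmentedLaw a b x ≠ 0 := by
  intro h
  have h1 : augmentedLaw a b x Set.univ = 0 := by simp [h]
  rw [augmentedLaw, Measure.map_apply (measurable_addJumps x) MeasurableSet.univ, Set.preimage_univ,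
    ← Set.univ_prod_univ, Measure.prod_prod, measure_univ, one_mul, Measure.pi_univ,
    Finset.prod_eq_zero_iff] at h1
  obtain ⟨i, -, hi⟩ := h1
  exact expDensity_ne_zero _ (Measure.measure_univ_eq_zero.1 hi)

variable {b}

theorem posteriorWeight_univ_ne_zero
    (hU : ∀ᵐ U ∂crmLaw a b, 0 < U Set.univ ∧ U Set.univ < ∞) {n : ℕ} (x : Fin n → X) :
    posteriorWeight a b x Set.univ ≠ 0 := by
  rw [posteriorWeight_univ, Ne, lintegral_eq_zero_iff (measurable_inv_mass_pow n)]
  intro h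
  have h2 : ∀ᵐ _ ∂augmentedLaw a b x, False := by
    filter_upwards [h, augmentedLaw_ae_mass a b hU x] with V h1 h2
    exact pow_ne_zero n (ENNReal.inv_ne_zero.2 h2.2) h1
  rw [eventually_false_iff_eq_bot, ae_eq_bot] at h2
  exact augmentedLaw_ne_zero a b x h2

theorem measurable_posteriorWeight (hb : Measurable b) (n : ℕ) :
    Measurable fun x : Fin n → X => posteriorWeight a b x := by
  refine Measure.measurable_of_measurable_coe _ fun C hC => ?_
  simp_rw [fun x : Fin n → X => posteriorWeight_apply a b x hC]
  exact measurable_lintegral_augmentedLaw a hb (H := fun q => (q.2 Set.univ)⁻¹ ^ n *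
    C.indicator 1 (normalise q.2)) (((measurable_inv_mass_pow n).mul
      ((measurable_one.indicator hC).comp measurable_normalise)).comp measurable_snd)

theorem measurable_psi : Measurable fun l : ℝ => psi a b l := by
  have : SFinite (intensity a b) := by unfold intensity; infer_instance
  have h : Measurable fun q : ℝ × (X × ℝ) => ENNReal.ofReal (1 - Real.exp (-(q.1 * q.2.2))) := by
    fun_prop
  exact h.lintegral_prod_right'.ennreal_toReal

theorem measurable_mixingDensity {n : ℕ} (x : Fin n → X) :
    Measurable (mixingDensity a b x) := by
  have := measurable_psi a (b := b)
  unfold mixingDensity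
  fun_prop

variable (b) in
/-- The law of `V = U + ∑ᵢ wᵢ δ_{xᵢ}` tilted by `l^{n-1} e^{-l V(𝔛)}`, after normalisation. -/
def tiltedLaw {n : ℕ} (x : Fin n → X) (l : ℝ) : Measure (Measure X) :=
  ENNReal.ofReal (l ^ (n - 1)) • ((augmentedLaw a b x).withDensity
    fun V => expNeg (ENNReal.ofReal l * V Set.univ)).map normalise

theorem lintegral_tiltedLaw {n : ℕ} (x : Fin n → X) (l : ℝ) {F : Measure X → ℝ≥0∞}
    (hF : Measurable F) : ∫⁻ P, F P ∂tiltedLaw a b x l =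
      ∫⁻ V, ENNReal.ofReal (l ^ (n - 1)) *
        (expNeg (ENNReal.ofReal l * V Set.univ) * F (normalise V)) ∂augmentedLaw a b x := by
  have hFn : Measurable fun V : Measure X => F (normalise V) := hF.comp measurable_normalise
  have hm : Measurable fun V : Measure X => expNeg (ENNReal.ofReal l * V Set.univ) *
      F (normalise V) := (measurable_expNeg_mass l).mul hFn
  rw [tiltedLaw, lintegral_smul_measure, lintegral_map hF measurable_normalise, smul_eq_mul,
    lintegral_withDensity_eq_lintegral_mul _ (measurable_expNeg_mass l) hFn,
    lintegral_const_mul _ hm]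
  rfl

theorem measurable_tilt (n : ℕ) {F : Measure X → ℝ≥0∞}
    (hF : Measurable F) : Measurable fun q : ℝ × Measure X => ENNReal.ofReal (q.1 ^ (n - 1)) *
      (expNeg (ENNReal.ofReal q.1 * q.2 Set.univ) * F (normalise q.2)) := by
  have h1 : Measurable fun q : ℝ × Measure X => q.2 Set.univ :=
    (Measure.measurable_coe MeasurableSet.univ).comp measurable_snd
  have h2 : Measurable fun q : ℝ × Measure X => F (normalise q.2) :=
    (hF.comp measurable_normalise).comp measurable_snd
  have h3 : Measurable fun q : ℝ × Measure X => expNeg (ENNReal.ofReal q.1 * q.2 Set.univ) :=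
    measurable_expNeg.comp (measurable_fst.ennreal_ofReal.mul h1)
  exact (measurable_fst.pow_const _).ennreal_ofReal.mul (h3.mul h2)

theorem measurable_tiltedLaw {n : ℕ} (x : Fin n → X) : Measurable (tiltedLaw a b x) := by
  refine Measure.measurable_of_measurable_coe _ fun C hC => ?_
  have hind : Measurable (C.indicator (1 : Measure X → ℝ≥0∞)) := measurable_one.indicator hC
  have h : ∀ l, tiltedLaw a b x l C = ∫⁻ V, ENNReal.ofReal (l ^ (n - 1)) *
      (expNeg (ENNReal.ofReal l * V Set.univ) * C.indicator 1 (normalise V))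
        ∂augmentedLaw a b x := fun l => by
    rw [← lintegral_indicator_one hC, lintegral_tiltedLaw a x l hind]
  simp_rw [h]
  exact (measurable_tilt n hind).lintegral_prod_right'

variable (b) in
/-- The conditional law of the posterior random measure given `Λ = l`. -/
def conditionalPosterior {n : ℕ} (x : Fin n → X) (l : ℝ) : Measure (Measure X) :=
  ((crmLaw a fun y => l.toNNReal + b y).prod
    (Measure.pi fun i => expMeasure (l + (b (x i) : ℝ)))).map fun p => normalise (addJumps x p)

theorem posterior_eq_bind {n : ℕ} (x : Fin n → X) :
    posterior a b x = (mixingLaw a b x).bind (conditionalPosterior a b x) := rfl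

/-- The conditional law given `Λ = l`, weighted by the mixing density, is an exponential tilt of
the augmented law. -/
theorem ofReal_smul_conditionalPosterior (hb : Measurable b)
    (hU : ∀ᵐ U ∂crmLaw a b, U Set.univ < ∞) {l : ℝ} (hl : 0 < l) {n : ℕ} (x : Fin n → X) :
    ENNReal.ofReal (mixingDensity a b x l) • conditionalPosterior a b x l =
      tiltedLaw a b x l := by
  have hcomp : Measurable fun p : Measure X × (Fin n → ℝ) => normalise (addJumps x p) :=
    measurable_normalise.comp (measurable_addJumps x)
  rw [mixingDensity, mul_assoc, ENNReal.ofReal_mul (by positivity), mul_smul, conditionalPosterior,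
    ← Measure.map_smul, prod_crmLaw_expMeasure_eq_withDensity a hb hU hl x,
    tiltedLaw, augmentedLaw,
    withDensity_map_comp _ (measurable_addJumps x) (measurable_expNeg_mass l),
    Measure.map_map measurable_normalise (measurable_addJumps x)]
  rfl

/-- Integrating out `Λ` by the Gamma integral leaves the weight `(n-1)! V(𝔛)^{-n}`. -/
theorem lintegral_mixingDensity_conditionalPosterior (hb : Measurable b)
    (hU : ∀ᵐ U ∂crmLaw a b, 0 < U Set.univ ∧ U Set.univ < ∞) {n : ℕ} (hn : 1 ≤ n) (x : Fin n → X)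
    {F : Measure X → ℝ≥0∞} (hF : Measurable F) :
    ∫⁻ l in Set.Ioi (0 : ℝ), ENNReal.ofReal (mixingDensity a b x l) *
        ∫⁻ P, F P ∂conditionalPosterior a b x l =
      (((n - 1)! : ℕ) : ℝ≥0∞) * ∫⁻ P, F P ∂posteriorWeight a b x := by
  have hU' : ∀ᵐ U ∂crmLaw a b, U Set.univ < ∞ := hU.mono fun U h => h.2
  have hF' : Measurable fun V : Measure X => (V Set.univ)⁻¹ ^ n * F (normalise V) :=
    (measurable_inv_mass_pow n).mul (hF.comp measurable_normalise)
  have htilt : ∀ l ∈ Set.Ioi (0 : ℝ), ENNReal.ofReal (mixingDensity a b x l) *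
      ∫⁻ P, F P ∂conditionalPosterior a b x l = ∫⁻ V, ENNReal.ofReal (l ^ (n - 1)) *
        (expNeg (ENNReal.ofReal l * V Set.univ) * F (normalise V)) ∂augmentedLaw a b x := by
    intro l hl
    rw [← smul_eq_mul, ← lintegral_smul_measure,
      ofReal_smul_conditionalPosterior a hb hU' hl x, lintegral_tiltedLaw a x l hF]
  rw [setLIntegral_congr_fun measurableSet_Ioi htilt,
    lintegral_lintegral_swap (measurable_tilt n hF).aemeasurable,
    lintegral_posteriorWeight a b x hF, ← lintegral_const_mul _ hF']
  refine lintegral_congr_ae ?_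
  filter_upwards [augmentedLaw_ae_mass a b hU x] with V hV
  have hm : Measurable fun l : ℝ => ENNReal.ofReal (l ^ (n - 1)) *
      expNeg (ENNReal.ofReal l * V Set.univ) := by fun_prop
  simp_rw [← mul_assoc]
  rw [lintegral_mul_const _ hm, lintegral_pow_mul_expNeg hn hV.1 hV.2]

theorem conditionalPosterior.isProbabilityMeasure (hb : ∀ x, 0 < b x) {n : ℕ} (x : Fin n → X)
    {l : ℝ} (hl : 0 < l) : IsProbabilityMeasure (conditionalPosterior a b x l) := by
  have : ∀ i, IsProbabilityMeasure (expMeasure (l + (b (x i) : ℝ))) := fun i =>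
    isProbabilityMeasure_expMeasure (by have := hb (x i); positivity)
  exact Measure.isProbabilityMeasure_map
    (measurable_normalise.comp (measurable_addJumps x)).aemeasurable

theorem mixingWeight_univ (hb : Measurable b) (hb_pos : ∀ x, 0 < b x)
    (hU : ∀ᵐ U ∂crmLaw a b, 0 < U Set.univ ∧ U Set.univ < ∞) {n : ℕ} (hn : 1 ≤ n)
    (x : Fin n → X) : mixingWeight a b x Set.univ =
      (((n - 1)! : ℕ) : ℝ≥0∞) * posteriorWeight a b x Set.univ := by
  have h := lintegral_mixingDensity_conditionalPosterior a hb hU hn x (F := fun _ => 1)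
    measurable_const
  rw [lintegral_one] at h
  rw [← h, mixingWeight_eq a b x, withDensity_apply _ MeasurableSet.univ, Measure.restrict_univ]
  refine setLIntegral_congr_fun measurableSet_Ioi fun l hl => ?_
  have := conditionalPosterior.isProbabilityMeasure a hb_pos x hl
  simp

theorem aemeasurable_conditionalPosterior (hb : Measurable b) (hb_pos : ∀ x, 0 < b x)
    (hU : ∀ᵐ U ∂crmLaw a b, U Set.univ < ∞) {n : ℕ} (x : Fin n → X) :
    AEMeasurable (conditionalPosterior a b x) (volume.restrict (Set.Ioi (0 : ℝ))) := by
  refine ⟨fun l => (ENNReal.ofReal (mixingDensity a b x l))⁻¹ • tiltedLaw a b x l,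
    measurable_smul_measure (measurable_mixingDensity a x).ennreal_ofReal.inv
      (measurable_tiltedLaw a x), ?_⟩
  filter_upwards [ae_restrict_mem measurableSet_Ioi] with l hl
  have hpos := mixingDensity_pos a hb_pos x hl
  rw [← ofReal_smul_conditionalPosterior a hb hU hl x, smul_smul,
    ENNReal.inv_mul_cancel (by simpa using hpos) ENNReal.ofReal_ne_top, one_smul]

/-- The posterior is the normalised version of `posteriorWeight`. -/
theorem posterior_eq (hb : Measurable b) (hb_pos : ∀ x, 0 < b x)
    (hU : ∀ᵐ U ∂crmLaw a b, 0 < U Set.univ ∧ U Set.univ < ∞) {n : ℕ} (hn : 1 ≤ n)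
    (x : Fin n → X) :
    posterior a b x = (posteriorWeight a b x Set.univ)⁻¹ • posteriorWeight a b x := by
  have hU' : ∀ᵐ U ∂crmLaw a b, U Set.univ < ∞ := hU.mono fun U h => h.2
  have hκ := aemeasurable_conditionalPosterior a hb hb_pos hU' x
  have hac : mixingLaw a b x ≪ volume.restrict (Set.Ioi (0 : ℝ)) :=
    (Measure.smul_absolutelyContinuous).trans (withDensity_absolutelyContinuous _ _)
  ext C hC
  have hind : Measurable (C.indicator (1 : Measure X → ℝ≥0∞)) := measurable_one.indicator hC
  have hf0 : (((n - 1)! : ℕ) : ℝ≥0∞) ≠ 0 := by exact_mod_cast (Nat.factorial_pos _).ne'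
  have hft : (((n - 1)! : ℕ) : ℝ≥0∞) ≠ ∞ := ENNReal.natCast_ne_top _
  have hκC : AEMeasurable (fun l => conditionalPosterior a b x l C)
      (volume.restrict (Set.Ioi (0 : ℝ))) := (Measure.measurable_coe hC).comp_aemeasurable hκ
  have h := lintegral_mixingDensity_conditionalPosterior a hb hU hn x hind
  simp_rw [lintegral_indicator_one hC] at h
  rw [posterior_eq_bind, Measure.bind_apply hC (hκ.mono_ac hac), mixingLaw, lintegral_smul_measure,
    mixingWeight_univ a hb hb_pos hU hn x, mixingWeight_eq a b x,
    lintegral_withDensity_eq_lintegral_mul₀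
      (measurable_mixingDensity a x).ennreal_ofReal.aemeasurable hκC]
  simp only [Pi.mul_apply]
  rw [h, Measure.smul_apply, smul_eq_mul, smul_eq_mul, ENNReal.mul_inv (Or.inl hf0) (Or.inl hft),
    mul_mul_mul_comm, ENNReal.inv_mul_cancel hf0 hft, one_mul]

end Posterior

/-! ### Finiteness of the normalising constant -/

section Final

variable {X : Type*} [MeasurableSpace X] (a : Measure X) [IsFiniteMeasure a] {b : X → ℝ≥0}

/-- For a single observation the normalising constant is finite at some point, since it integrates
to `E P(𝔛) = 1` against the urn measure. -/
theorem exists_posteriorWeight_univ_ne_top (hb : Measurable b)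
    (hU : ∀ᵐ U ∂crmLaw a b, 0 < U Set.univ ∧ U Set.univ < ∞) :
    ∃ y : Fin 1 → X, posteriorWeight a b y Set.univ ≠ ∞ := by
  have h := lintegral_crmLaw_prod a hb (n := 1) (B := fun _ => Set.univ)
    (fun _ => MeasurableSet.univ) (measurable_inv_mass_pow 1)
  have h1 : ∫⁻ U, (∏ _i : Fin 1, U Set.univ) * (U Set.univ)⁻¹ ^ 1 ∂crmLaw a b = 1 := by
    rw [← measure_univ (μ := crmLaw a b), ← lintegral_one]
    refine lintegral_congr_ae ?_
    filter_upwards [hU] with U hU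
    simp [ENNReal.mul_inv_cancel hU.1.ne' hU.2.ne]
  simp_rw [← posteriorWeight_univ] at h
  rw [h1, Set.pi_univ, Measure.restrict_univ] at h
  have hm : Measurable fun x : Fin 1 → X => posteriorWeight a b x Set.univ :=
    measurable_measure_apply (measurable_posteriorWeight a hb 1) MeasurableSet.univ
  have hne : urnMeasure a 1 ≠ 0 := by
    intro h0
    rw [h0, lintegral_zero_measure] at h
    exact one_ne_zero h
  have : NeBot (ae (urnMeasure a 1)) := ae_neBot.2 hne
  obtain ⟨y, hy⟩ := (ae_lt_top hm (by rw [← h]; exact ENNReal.one_ne_top)).exists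
  exact ⟨y, hy.ne⟩

/-- The normalising constants for `n` observations and for a single one are comparable, so they are
all finite once one of them is. -/
theorem posteriorWeight_univ_ne_top (hb : Measurable b) (hb_pos : ∀ x, 0 < b x)
    (hU : ∀ᵐ U ∂crmLaw a b, 0 < U Set.univ ∧ U Set.univ < ∞) {n : ℕ} (hn : 1 ≤ n)
    (x : Fin n → X) : posteriorWeight a b x Set.univ ≠ ∞ := by
  obtain ⟨y, hy⟩ := exists_posteriorWeight_univ_ne_top a hb hU
  obtain ⟨K, hK, hle⟩ := mixingDensity_le a hb_pos hn x y
  have hxw := mixingWeight_univ a hb hb_pos hU hn x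
  have hyw := mixingWeight_univ a hb hb_pos hU le_rfl y
  have hyfin : mixingWeight a b y Set.univ ≠ ∞ := by
    rw [hyw]
    exact ENNReal.mul_ne_top (ENNReal.natCast_ne_top _) hy
  have hlew : mixingWeight a b x Set.univ ≤ ENNReal.ofReal K * mixingWeight a b y Set.univ := by
    rw [mixingWeight_eq, mixingWeight_eq, withDensity_apply _ MeasurableSet.univ,
      withDensity_apply _ MeasurableSet.univ, Measure.restrict_univ,
      ← lintegral_const_mul _ (measurable_mixingDensity a y).ennreal_ofReal]
    refine setLIntegral_mono' measurableSet_Ioi fun l hl => ?_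
    rw [← ENNReal.ofReal_mul hK]
    exact ENNReal.ofReal_le_ofReal (hle l hl)
  have hxfin : mixingWeight a b x Set.univ ≠ ∞ :=
    ne_top_of_le_ne_top (ENNReal.mul_ne_top ENNReal.ofReal_ne_top hyfin) hlew
  intro htop
  rw [hxw, htop, ENNReal.mul_top] at hxfin
  · exact hxfin rfl
  · exact_mod_cast (Nat.factorial_pos _).ne'

/-! ### The posterior distribution -/

theorem posterior_isProbabilityMeasure (hb : Measurable b) (hb_pos : ∀ x, 0 < b x)
    (hU : ∀ᵐ U ∂crmLaw a b, 0 < U Set.univ ∧ U Set.univ < ∞) {n : ℕ} (hn : 1 ≤ n)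
    (x : Fin n → X) : IsProbabilityMeasure (posterior a b x) := by
  constructor
  rw [posterior_eq a hb hb_pos hU hn, Measure.smul_apply, smul_eq_mul]
  exact ENNReal.inv_mul_cancel (posteriorWeight_univ_ne_zero a hU x)
    (posteriorWeight_univ_ne_top a hb hb_pos hU hn x)

/-- The joint law of the observations and the random probability measure: it has the kernel
`posteriorWeight` with respect to the urn measure. -/
theorem setLIntegral_prior (hb : Measurable b) {n : ℕ} {B : Fin n → Set X}
    (hB : ∀ i, MeasurableSet (B i)) {C : Set (Measure X)} (hC : MeasurableSet C) :
    ∫⁻ P in C, ∏ i, P (B i) ∂prior a b =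
      ∫⁻ x in Set.univ.pi B, posteriorWeight a b x C ∂urnMeasure a n := by
  have hprod : Measurable fun P : Measure X => ∏ i, P (B i) :=
    Finset.measurable_prod _ fun i _ => Measure.measurable_coe (hB i)
  have hG : Measurable fun U : Measure X => (U Set.univ)⁻¹ ^ n * C.indicator 1 (normalise U) :=
    (measurable_inv_mass_pow n).mul ((measurable_one.indicator hC).comp measurable_normalise)
  simp_rw [posteriorWeight_apply a b _ hC]
  rw [← lintegral_crmLaw_prod a hb hB hG, ← lintegral_indicator hC, prior,
    lintegral_map (hprod.indicator hC) measurable_normalise]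
  refine lintegral_congr fun U => ?_
  by_cases hUC : normalise U ∈ C
  · rw [Set.indicator_of_mem hUC, Set.indicator_of_mem hUC]
    simp only [normalise, Measure.smul_apply, smul_eq_mul, Finset.prod_mul_distrib,
      Finset.prod_const, Finset.card_univ, Fintype.card_fin, Pi.one_apply]
    ring
  · simp [Set.indicator_of_notMem hUC]

theorem isPosterior_posterior (hb : Measurable b) (hb_pos : ∀ x, 0 < b x)
    (hU : ∀ᵐ U ∂crmLaw a b, 0 < U Set.univ ∧ U Set.univ < ∞) {n : ℕ} (hn : 1 ≤ n) :
    IsPosterior (prior a b) n fun x : Fin n → X => posterior a b x := by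
  have hWm := measurable_posteriorWeight a hb n
  have hW1 : Measurable fun x : Fin n → X => posteriorWeight a b x Set.univ :=
    measurable_measure_apply hWm MeasurableSet.univ
  have hpost : Measurable fun x : Fin n → X => posterior a b x := by
    simp_rw [posterior_eq a hb hb_pos hU hn]
    exact measurable_smul_measure hW1.inv hWm
  refine ⟨hpost, posterior_isProbabilityMeasure a hb hb_pos hU hn,
    -- the marginal law of the observations
    (urnMeasure a n).withDensity fun x => posteriorWeight a b x Set.univ, ?_, ?_⟩
  · intro B hB
    rw [withDensity_apply _ (MeasurableSet.univ_pi hB), ← setLIntegral_prior a hb hB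
      MeasurableSet.univ, Measure.restrict_univ]
  · intro C hC B hB
    have hpC : Measurable fun x : Fin n → X => posterior a b x C :=
      measurable_measure_apply hpost hC
    rw [setLIntegral_prior a hb hB hC, setLIntegral_withDensity_eq_setLIntegral_mul _ hW1 hpC
      (MeasurableSet.univ_pi hB)]
    refine lintegral_congr fun x => ?_
    simp only [Pi.mul_apply]
    rw [posterior_eq a hb hb_pos hU hn, Measure.smul_apply, smul_eq_mul, ← mul_assoc,
      ENNReal.mul_inv_cancel (posteriorWeight_univ_ne_zero a hU x)
        (posteriorWeight_univ_ne_top a hb hb_pos hU hn x), one_mul]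

/-! ### The posterior mean -/

/-- One more observation at `y` multiplies the normalising constant by at most `1 / n`. -/
theorem natCast_mul_posteriorWeight_cons_le (hb : Measurable b) (hb_pos : ∀ x, 0 < b x)
    (hU : ∀ᵐ U ∂crmLaw a b, 0 < U Set.univ ∧ U Set.univ < ∞) {n : ℕ} (hn : 1 ≤ n)
    (x : Fin n → X) (y : X) :
    (n : ℝ≥0∞) * posteriorWeight a b (Fin.cons y x : Fin (n + 1) → X) Set.univ ≤
      posteriorWeight a b x Set.univ := by
  have h1 := mixingWeight_univ a hb hb_pos hU hn x
  have h2 := mixingWeight_univ a hb hb_pos hU (Nat.le_add_left 1 n)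
    (Fin.cons y x : Fin (n + 1) → X)
  have hle : mixingWeight a b (Fin.cons y x : Fin (n + 1) → X) Set.univ ≤
      mixingWeight a b x Set.univ := by
    rw [mixingWeight_eq, mixingWeight_eq, withDensity_apply _ MeasurableSet.univ,
      withDensity_apply _ MeasurableSet.univ, Measure.restrict_univ]
    exact setLIntegral_mono' measurableSet_Ioi fun l hl =>
      ENNReal.ofReal_le_ofReal (mixingDensity_cons_le a hb_pos hn x y hl)
  have hfac : ((n + 1 - 1)! : ℕ) = (n - 1)! * n := by
    rw [Nat.add_sub_cancel, mul_comm, Nat.mul_factorial_pred (by omega)]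
  rw [h1, h2, hfac, Nat.cast_mul, mul_assoc] at hle
  exact (ENNReal.mul_le_mul_iff_right (by exact_mod_cast (Nat.factorial_pos _).ne')
    (ENNReal.natCast_ne_top _)).1 hle

/-- The posterior mean charges the observations with at most the empirical weights, and the rest of
the space with at most `n⁻¹ a`. -/
theorem lintegral_posterior_apply_le (hb : Measurable b) (hb_pos : ∀ x, 0 < b x)
    (hU : ∀ᵐ U ∂crmLaw a b, 0 < U Set.univ ∧ U Set.univ < ∞) {n : ℕ} (hn : 1 ≤ n)
    (x : Fin n → X) {A : Set X} (hA : MeasurableSet A) :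
    ∫⁻ P, P A ∂posterior a b x ≤ empirical x A + (n : ℝ≥0∞)⁻¹ * a Set.univ := by
  set W := posteriorWeight a b x Set.univ with hW
  have hW0 : W ≠ 0 := posteriorWeight_univ_ne_zero a hU x
  have hWt : W ≠ ∞ := posteriorWeight_univ_ne_top a hb hb_pos hU hn x
  have hn0 : (n : ℝ≥0∞) ≠ 0 := by exact_mod_cast (by omega : n ≠ 0)
  set κ : X → ℝ≥0∞ := fun y =>
    W⁻¹ * posteriorWeight a b (Fin.cons y x : Fin (n + 1) → X) Set.univ with hκ
  have hκle : ∀ y, κ y ≤ (n : ℝ≥0∞)⁻¹ := by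
    intro y
    have h := natCast_mul_posteriorWeight_cons_le a hb hb_pos hU hn x y
    have h' : posteriorWeight a b (Fin.cons y x : Fin (n + 1) → X) Set.univ ≤
        (n : ℝ≥0∞)⁻¹ * W := by
      have h2 := mul_le_mul_right h (n : ℝ≥0∞)⁻¹
      rwa [← mul_assoc, ENNReal.inv_mul_cancel hn0 (ENNReal.natCast_ne_top n), one_mul] at h2
    calc κ y ≤ W⁻¹ * ((n : ℝ≥0∞)⁻¹ * W) := mul_le_mul_right h' _
      _ = (n : ℝ≥0∞)⁻¹ := by
        rw [mul_comm, mul_assoc, ENNReal.mul_inv_cancel hW0 hWt, mul_one]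
  -- the Mecke formula, with `P A = V A / V(𝔛)` raising the power of `V(𝔛)⁻¹` from `n` to `n + 1`
  have hmean : ∫⁻ P, P A ∂posterior a b x =
      ∫⁻ y in A, κ y ∂a + ∑ i, A.indicator κ (x i) := by
    have hJ : Measurable fun y : X =>
        posteriorWeight a b (Fin.cons y x : Fin (n + 1) → X) Set.univ :=
      (measurable_measure_apply (measurable_posteriorWeight a hb (n + 1)) MeasurableSet.univ).comp
        (measurable_fin_cons_left x)
    rw [posterior_eq a hb hb_pos hU hn, lintegral_smul_measure,
      lintegral_posteriorWeight a b x (Measure.measurable_coe hA), smul_eq_mul]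
    have h1 : ∀ V : Measure X, (V Set.univ)⁻¹ ^ n * normalise V A =
        V A * (V Set.univ)⁻¹ ^ (n + 1) := by
      intro V
      rw [normalise, Measure.smul_apply, smul_eq_mul]
      ring
    simp_rw [h1]
    rw [lintegral_augmentedLaw_mecke a hb hA x (measurable_inv_mass_pow (n + 1))]
    simp_rw [← posteriorWeight_univ]
    rw [mul_add, ← lintegral_const_mul _ hJ, Finset.mul_sum]
    congr 1
    refine Finset.sum_congr rfl fun i _ => ?_
    by_cases hi : x i ∈ A <;> simp [hi, hκ, hW]
  rw [hmean, add_comm]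
  refine add_le_add ?_ ?_
  · rw [empirical, Measure.smul_apply, Measure.coe_finsetSum, Finset.sum_apply, smul_eq_mul,
      Finset.mul_sum]
    refine Finset.sum_le_sum fun i _ => ?_
    rw [Measure.dirac_apply' _ hA]
    by_cases hi : x i ∈ A
    · simpa [hi] using hκle (x i)
    · simp [hi]
  · calc ∫⁻ y in A, κ y ∂a ≤ ∫⁻ _, (n : ℝ≥0∞)⁻¹ ∂a :=
        (setLIntegral_le_lintegral _ _).trans (lintegral_mono hκle)
      _ = (n : ℝ≥0∞)⁻¹ * a Set.univ := lintegral_const _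

theorem posterior_ae_univ (hb : Measurable b) (hb_pos : ∀ x, 0 < b x)
    (hU : ∀ᵐ U ∂crmLaw a b, 0 < U Set.univ ∧ U Set.univ < ∞) {n : ℕ} (hn : 1 ≤ n)
    (x : Fin n → X) : ∀ᵐ P ∂posterior a b x, P Set.univ = 1 := by
  rw [posterior_eq a hb hb_pos hU hn]
  refine Measure.ae_smul_measure ?_ _
  have hms : MeasurableSet {P : Measure X | P Set.univ = 1} :=
    Measure.measurable_coe MeasurableSet.univ (measurableSet_singleton 1)
  rw [posteriorWeight, ae_map_iff measurable_normalise.aemeasurable hms]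
  refine (withDensity_absolutelyContinuous _ _).ae_le ?_
  filter_upwards [augmentedLaw_ae_mass a b hU x] with V hV
  rw [normalise, Measure.smul_apply, smul_eq_mul, ENNReal.inv_mul_cancel hV.1 hV.2]

theorem empirical_isProbabilityMeasure {Y : Type*} [MeasurableSpace Y] {n : ℕ} (hn : 1 ≤ n)
    (x : Fin n → Y) : IsProbabilityMeasure (empirical x) := by
  constructor
  have hn0 : (n : ℝ≥0∞) ≠ 0 := by exact_mod_cast (by omega : n ≠ 0)
  simp [empirical, ENNReal.inv_mul_cancel hn0 (ENNReal.natCast_ne_top n)]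

/-- The posterior mean is within `a(𝔛) / n` of the empirical distribution. The lower bound on a set
is the upper bound on its complement. -/
theorem abs_integral_posterior_sub_empirical_le (hb : Measurable b) (hb_pos : ∀ x, 0 < b x)
    (hU : ∀ᵐ U ∂crmLaw a b, 0 < U Set.univ ∧ U Set.univ < ∞) {n : ℕ} (hn : 1 ≤ n)
    (x : Fin n → X) {A : Set X} (hA : MeasurableSet A) :
    |∫ P, P.real A ∂posterior a b x - (empirical x).real A| ≤ a.real Set.univ / n := by
  have := posterior_isProbabilityMeasure a hb hb_pos hU hn x
  have := empirical_isProbabilityMeasure hn x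
  have hn0 : (n : ℝ≥0∞) ≠ 0 := by exact_mod_cast (by omega : n ≠ 0)
  set c : ℝ≥0∞ := (n : ℝ≥0∞)⁻¹ * a Set.univ with hc
  have hct : c ≠ ∞ := ENNReal.mul_ne_top (ENNReal.inv_ne_top.2 hn0) (measure_ne_top _ _)
  have hcr : c.toReal = a.real Set.univ / n := by
    rw [hc, ENNReal.toReal_mul, ENNReal.toReal_inv, ENNReal.toReal_natCast, measureReal_def]
    ring
  have hae := posterior_ae_univ a hb hb_pos hU hn x
  set e : ℝ≥0∞ := ∫⁻ P, P A ∂posterior a b x with he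
  set e' : ℝ≥0∞ := ∫⁻ P, P Aᶜ ∂posterior a b x with he'
  have hsum : e + e' = 1 := by
    rw [he, he', ← lintegral_add_left (Measure.measurable_coe hA),
      ← measure_univ (μ := posterior a b x), ← lintegral_one]
    refine lintegral_congr_ae ?_
    filter_upwards [hae] with P hP
    rw [measure_add_measure_compl hA, hP]
  have het : e ≠ ∞ := ne_top_of_le_ne_top ENNReal.one_ne_top (hsum ▸ le_self_add)
  have he't : e' ≠ ∞ := ne_top_of_le_ne_top ENNReal.one_ne_top (hsum ▸ le_add_self)
  have h1 : e ≤ empirical x A + c := lintegral_posterior_apply_le a hb hb_pos hU hn x hA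
  have h2 : e' ≤ empirical x Aᶜ + c := lintegral_posterior_apply_le a hb hb_pos hU hn x hA.compl
  have hint : ∫ P, P.real A ∂posterior a b x = e.toReal := by
    refine integral_toReal (Measure.measurable_coe hA).aemeasurable ?_
    filter_upwards [hae] with P hP
    exact ((measure_mono (Set.subset_univ A)).trans_eq hP).trans_lt ENNReal.one_lt_top
  have hsum' : e.toReal + e'.toReal = 1 := by
    rw [← ENNReal.toReal_add het he't, hsum, ENNReal.toReal_one]
  have h1' : e.toReal ≤ (empirical x).real A + c.toReal := by
    rw [measureReal_def, ← ENNReal.toReal_add (measure_ne_top _ _) hct]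
    exact ENNReal.toReal_mono (ENNReal.add_ne_top.2 ⟨measure_ne_top _ _, hct⟩) h1
  have h2' : e'.toReal ≤ (empirical x).real Aᶜ + c.toReal := by
    rw [measureReal_def, ← ENNReal.toReal_add (measure_ne_top _ _) hct]
    exact ENNReal.toReal_mono (ENNReal.add_ne_top.2 ⟨measure_ne_top _ _, hct⟩) h2
  have hemp : (empirical x).real A + (empirical x).real Aᶜ = 1 := by
    rw [measureReal_add_measureReal_compl hA, probReal_univ]
  rw [hint, ← hcr, abs_le]
  constructor <;> linarith

end Final

end ExtGamma

end

theorem theorem7p2 {X : Type*} [TopologicalSpace X] [PolishSpace X] [MeasurableSpace X]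
    [BorelSpace X] (a : Measure X) [IsFiniteMeasure a] (ha : ∀ x, a {x} = 0)
    (b : X → ℝ≥0) (hb : Measurable b) (hb_pos : ∀ x, 0 < b x)
    (hU : ∀ᵐ U ∂(ExtGamma.crmLaw a b), 0 < U Set.univ ∧ U Set.univ < ∞)
    (P₀ : Measure X) [IsProbabilityMeasure P₀] :
    (∀ n : ℕ, 1 ≤ n → ExtGamma.IsPosterior (ExtGamma.prior a b) n
      fun x : Fin n → X => ExtGamma.posterior a b x) ∧
    ∀ᵐ x ∂(Measure.infinitePi fun _ : ℕ => P₀),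
      (fun n : ℕ => ⨆ A : {A : Set X // MeasurableSet A},
        |∫ P, P.real (A : Set X) ∂(ExtGamma.posterior a b fun i : Fin n => x i) -
          (ExtGamma.empirical fun i : Fin n => x i).real (A : Set X)|)
        =O[atTop] fun n : ℕ => (1 : ℝ) / (n : ℝ) := by
  -- the bound `a(𝔛) / n` holds along every sequence, whatever `P₀` is
  refine ⟨fun n hn => ExtGamma.isPosterior_posterior a hb hb_pos hU hn,
    ae_of_all _ fun x => IsBigO.of_bound (a.real Set.univ) ?_⟩
  filter_upwards [eventually_ge_atTop 1] with n hn
  have : Nonempty {A : Set X // MeasurableSet A} := ⟨⟨∅, MeasurableSet.empty⟩⟩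
  rw [Real.norm_of_nonneg (Real.iSup_nonneg fun A => abs_nonneg _),
    Real.norm_of_nonneg (by positivity), mul_one_div]
  exact ciSup_le fun A =>
    ExtGamma.abs_integral_posterior_sub_empirical_le a hb hb_pos hU hn _ A.2
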